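/- Let $\mathbb{E}$ be a real vector space of finite dimension $n$ with dual space $\mathbb{E}^*$, and write $\langle s,x\rangle$ for the value of $s\in\mathbb{E}^*$ at $x\in\mathbb{E}$. For linear operators $A,A_1:\mathbb{E}\to\mathbb{E}^*$ write $A\preceq A_1$ if $\langle (A_1-A)x,x\rangle\ge 0$ for all $x\in\mathbb{E}$. For a vector $u\in\mathbb{E}$, let $uu^*:\mathbb{E}^*\to\mathbb{E}$ be the operator $s\mapsto\langle s,u\rangle u$. For self-adjoint positive definite $A,G:\mathbb{E}\to\mathbb{E}^*$, $\phi\in[0,1]$ and $u\in\mathbb{E}\setminus\{0\}$, define $$\mathrm{Broyd}_\phi(A,G,u)=\phi\Big[G-\tfrac{Auu^*G+Guu^*A}{\langle Au,u\rangle}+\Big(\tfrac{\langle Gu,u\rangle}{\langle Au,u\rangle}+1\Big)\tfrac{Auu^*A}{\langle Au,u\rangle}\Big]+(1-\phi)\Big[G-\tfrac{Guu^*G}{\langle Gu,u\rangle}+\tfrac{Auu^*A}{\langle Au,u\rangle}\Big],$$ and $\mathrm{Broyd}_\phi(A,G,0)=G$. The case $\phi=1$ is the DFP update and the case $\phi=0$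 is the BFGS update. Let $B:\mathbb{E}\to\mathbb{E}^*$ be a self-adjoint positive definite linear operator, let $\mu,L>0$ and $M\ge 0$, and let $f:\mathbb{E}\to\mathbb{R}$ be a twice differentiable function with gradient $\nabla f(x)\in\mathbb{E}^*$ and Hessian $\nabla^2 f(x):\mathbb{E}\to\mathbb{E}^*$ such that - $\mu B\preceq\nabla^2 f(x)\preceq LB$ for all $x\in\mathbb{E}$ (strong convexity with parameter $\mu$ and Lipschitz continuity of the gradient with constant $L$, with respect to $B$); - $\nabla^2 f(y)-\nabla^2 f(x)\preceq M\,\langle\nabla^2 f(z)(y-x),y-x\rangle^{1/2}\,\nabla^2 f(w)$ for all $x,y,z,w\in\mathbb{E}$ (strong self-concordance with constant $M$). Put $\lambda_f(x)=\langle\nabla f(x),\nabla^2 f(x)^{-1}\nabla f(x)\rangle^{1/2}$. Let $x_0\in\mathbb{E}$ and $G_0=LB$, and for $k\ge 0$ let $$x_{k+1}=x_k-G_k^{-1}\nabla f(x_k),\qquad u_k=x_{k+1}-x_k,\qquad J_k=\int_0^1\nabla^2 f(x_k+tu_k)\,dt,\qquad G_{k+1}=\mathrm{Broyd}_{\phi_k}(J_k,G_k,u_k),$$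 where the parameters $\phi_k\in[0,1]$ are arbitrary. Suppose that $$M\lambda_f(x_0)\le\frac{\ln\frac32}{4}\,\frac{\mu}{L}.$$ Then the scheme is well defined, in that all operators $G_k$ and $J_k$, $k\ge 0$, are self-adjoint and positive definite, and for all $k\ge 1$ $$\lambda_f(x_k)\le\frac{1}{\prod_{i=0}^{k-1}\left(\phi_i\frac{\mu}{L}+1-\phi_i\right)^{1/2}}\left(\frac{11nL}{\mu k}\right)^{k/2}\lambda_f(x_0).$$ In particular, for all $k\ge 1$: if $\phi_i=0$ for all $i$ (the BFGS method), then $\lambda_f(x_k)\le\left(\frac{11nL}{\mu k}\right)^{k/2}\lambda_f(x_0)$; and if $\phi_i=1$ for all $i$ (the DFP method), then $\lambda_f(x_k)\le\left(\frac{11nL^2}{\mu^2 k}\right)^{k/2}\lambda_f(x_0)$. -/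

import Mathlib

namespace QuasiNewton

noncomputable section

variable {E : Type*} [NormedAddCommGroup E] [NormedSpace ℝ E]

/-- Linear operators from the space `E` to its dual space. The pairing of a functional `s` with a
vector `x` is the evaluation `s x`. -/
abbrev DualOp (E : Type*) [NormedAddCommGroup E] [NormedSpace ℝ E] : Type _ :=
  E →L[ℝ] StrongDual ℝ E

/-- `A` is self-adjoint and positive definite. -/
def PosDefOp (A : DualOp E) : Prop :=
  (∀ x y : E, A x y = A y x) ∧ ∀ x : E, x ≠ 0 → 0 < A x x

/-- The partial ordering of operators: `⟨(A₁ - A) x, x⟩ ≥ 0` for all `x`. -/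
def OpLE (A A₁ : DualOp E) : Prop :=
  ∀ x : E, 0 ≤ (A₁ - A) x x

/-- The norm `⟨A h, h⟩ ^ (1/2)` on `E`. -/
def primalNorm (A : DualOp E) (h : E) : ℝ :=
  Real.sqrt (A h h)

/-- The conjugate norm `⟨s, A⁻¹ s⟩ ^ (1/2)` on the dual space. -/
def dualNorm (A : DualOp E) (s : StrongDual ℝ E) : ℝ :=
  Real.sqrt (s (A.inverse s))

/-- The gradient of `f` at `x`, an element of the dual space. -/
def grad (f : E → ℝ) (x : E) : StrongDual ℝ E :=
  fderiv ℝ f x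

/-- The Hessian of `f` at `x`, an operator from `E` to the dual space. -/
def hess (f : E → ℝ) (x : E) : DualOp E :=
  fderiv ℝ (fderiv ℝ f) x

/-- The local norm of the gradient. -/
def lam (f : E → ℝ) (x : E) : ℝ :=
  dualNorm (hess f x) (grad f x)

/-- The integral Hessian along the segment from `x` to `x + u`. -/
def integralHess (f : E → ℝ) (x u : E) : DualOp E :=
  ∫ t in (0 : ℝ)..1, hess f (x + t • u)

/-- Strong self-concordance with constant `M`. -/
def StronglySelfConcordant (f : E → ℝ) (M : ℝ) : Prop :=
  ∀ x y z w : E,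
    OpLE (hess f y - hess f x) ((M * primalNorm (hess f z) (y - x)) • hess f w)

/-- The rank-one operator `u u*` from the dual space to `E`, mapping `s` to `⟨s, u⟩ u`. -/
def outer (u : E) : StrongDual ℝ E →L[ℝ] E :=
  (ContinuousLinearMap.apply ℝ ℝ u).smulRight u

/-- The DFP update (for a nonzero direction). -/
def DFP (A G : DualOp E) (u : E) : DualOp E :=
  G - (A u u)⁻¹ • (A ∘L outer u ∘L G + G ∘L outer u ∘L A)
    + ((G u u / A u u + 1) * (A u u)⁻¹) • (A ∘L outer u ∘L A)

/-- The BFGS update (for a nonzero direction). -/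
def BFGS (A G : DualOp E) (u : E) : DualOp E :=
  G - (G u u)⁻¹ • (G ∘L outer u ∘L G) + (A u u)⁻¹ • (A ∘L outer u ∘L A)

open Classical in
/-- The Broyden family of updates of `G` with respect to `A` along `u`. -/
def Broyd (φ : ℝ) (A G : DualOp E) (u : E) : DualOp E :=
  if u = 0 then G else φ • DFP A G u + (1 - φ) • BFGS A G u

/-- `x` and `G` are the iterates and the Hessian approximations generated by the quasi-Newton
scheme for `f` with initial approximation `L B` and parameters `φ` from the convex Broyden
class. -/
structure IsQuasiNewtonRun (f : E → ℝ) (B : DualOp E) (L : ℝ) (φ : ℕ → ℝ)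
    (x : ℕ → E) (G : ℕ → DualOp E) : Prop where
  init : G 0 = L • B
  param_mem : ∀ k, φ k ∈ Set.Icc (0 : ℝ) 1
  step : ∀ k, x (k + 1) = x k - (G k).inverse (grad f (x k))
  update : ∀ k, G (k + 1) =
    Broyd (φ k) (integralHess f (x k) (x (k + 1) - x k)) (G k) (x (k + 1) - x k)

end

end QuasiNewton

/-! Put κ = μ/L, let r_k be M times the local length of the k-th step, and D_k = r_0 + … + r_{k-1}.
By strong self-concordance, J_k agrees with the Hessian at either end of the step up to a factor
exp(r_k/2), so changes of reference operator accumulate to exp(D_k).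

Since ∇f(x_{k+1}) = (J_k - G_k) u_k and ∇f(x_k) = -G_k u_k, one gets λ_{k+1}² ≤ exp(r_k) R_k λ_k²,
where R_k is the squared length of (G_k - J_k) u_k relative to G_k u_k in the norm of J_k⁻¹
(`lam_sq_step_le`). The same R_k measures the gain of the update: tr(A⁻¹G) + tr(G⁻¹A), taken at A =
J_k, drops by at least a fixed multiple of w_k R_k, with w_k = φ_k κ + 1 - φ_k
(`relTrace_Broyd_add_le`). This potential is nonnegative and starts at no more than 2n/κ, so ∑ w_i
R_i = O(n/κ) (`sum_weighted_stepRatio_le`), and AM–GM bounds ∏ w_i R_i by the k-th power of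
O(n/(κk)): this is the superlinear rate.

The constants require D_k to be bounded uniformly in k. Broyden updates preserve the two-sided
bounds between G and its target, which yields linear convergence with factor 1 - κ/2. The r_k are
then dominated by a geometric series, and the condition on x_0 keeps exp(D_k) ≤ 7/5
(`GoodIterate.succ`). -/

namespace QuasiNewton

/-! ### Positive definite operators, their inverses and conjugate norms -/

section Operators

variable {E : Type*} [NormedAddCommGroup E] [NormedSpace ℝ E]

lemma opLE_iff {A A₁ : DualOp E} : OpLE A A₁ ↔ ∀ x, A x x ≤ A₁ x x := by
  simp [OpLE]

lemma PosDefOp.nonneg {A : DualOp E} (hA : PosDefOp A) (x : E) : 0 ≤ A x x := by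
  rcases eq_or_ne x 0 with rfl | hx
  · simp
  · exact (hA.2 x hx).le

lemma PosDefOp.eq_zero_of_apply_self {A : DualOp E} (hA : PosDefOp A) {x : E} (hx : A x x = 0) :
    x = 0 := by
  by_contra h
  exact (hA.2 x h).ne' hx

lemma PosDefOp.smul {A : DualOp E} (hA : PosDefOp A) {c : ℝ} (hc : 0 < c) : PosDefOp (c • A) :=
  ⟨fun x y => by simp [hA.1 x y], fun x hx => by simpa using mul_pos hc (hA.2 x hx)⟩

lemma PosDefOp.of_le {A G : DualOp E} (hA : PosDefOp A) (hG : ∀ x y, G x y = G y x) {c : ℝ}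
    (h : ∀ x, A x x ≤ c * G x x) (hc : 0 < c) : PosDefOp G :=
  ⟨hG, fun x hx => pos_of_mul_pos_right ((hA.2 x hx).trans_le (h x)) hc.le⟩

lemma apply_sub_smul_self {A : DualOp E} (hA : ∀ x y, A x y = A y x) (x y : E) (t : ℝ) :
    A (x - t • y) (x - t • y) = A x x - 2 * t * A x y + t ^ 2 * A y y := by
  simp only [map_sub, map_smul, sub_apply, smul_apply,
    smul_eq_mul, hA y x]
  ring

lemma PosDefOp.cauchy_schwarz {A : DualOp E} (hA : PosDefOp A) (x y : E) :
    A x y ^ 2 ≤ A x x * A y y := by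
  rcases eq_or_ne y 0 with rfl | hy
  · simp
  · have hpos := hA.2 y hy
    have h := hA.nonneg (x - (A x y / A y y) • y)
    rw [apply_sub_smul_self hA.1] at h
    have h' : A x x - 2 * (A x y / A y y) * A x y + (A x y / A y y) ^ 2 * A y y
        = (A x x * A y y - A x y ^ 2) / A y y := by
      field_simp
      ring
    rw [h', div_nonneg_iff] at h
    rcases h with h | h <;> linarith [h.1, h.2]

variable [FiniteDimensional ℝ E]

/-- Definiteness gives injectivity, and the dimensions agree. Hence `inverse` is a genuine inverse
here and not its default value zero. -/
lemma PosDefOp.exists_equiv {A : DualOp E} (hA : PosDefOp A) :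
    ∃ e : E ≃L[ℝ] StrongDual ℝ E, (e : E →L[ℝ] StrongDual ℝ E) = A := by
  have hinj : Function.Injective (A : E →ₗ[ℝ] StrongDual ℝ E) := by
    rw [← LinearMap.ker_eq_bot, LinearMap.ker_eq_bot']
    intro x hx
    apply hA.eq_zero_of_apply_self
    have h : A x = 0 := hx
    simp [h]
  have hrank : Module.finrank ℝ E = Module.finrank ℝ (StrongDual ℝ E) := by
    rw [← Subspace.dual_finrank_eq (K := ℝ) (V := E)]
    exact (LinearMap.toContinuousLinearMap (𝕜 := ℝ) (E := E) (F' := ℝ)).finrank_eq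
  refine ⟨(LinearMap.linearEquivOfInjective _ hinj hrank).toContinuousLinearEquiv, ?_⟩
  ext x y
  simp

lemma PosDefOp.apply_inverse {A : DualOp E} (hA : PosDefOp A) (s : StrongDual ℝ E) :
    A (A.inverse s) = s := by
  obtain ⟨e, rfl⟩ := hA.exists_equiv
  simp

lemma PosDefOp.inverse_apply {A : DualOp E} (hA : PosDefOp A) (x : E) :
    A.inverse (A x) = x := by
  obtain ⟨e, rfl⟩ := hA.exists_equiv
  simp

lemma PosDefOp.inverse_eq_of_apply_eq {A : DualOp E} (hA : PosDefOp A) {s : StrongDual ℝ E} {x : E}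
    (h : A x = s) : A.inverse s = x := by
  rw [← h, hA.inverse_apply]

lemma PosDefOp.inverse_symm {A : DualOp E} (hA : PosDefOp A) (s t : StrongDual ℝ E) :
    s (A.inverse t) = t (A.inverse s) := by
  conv_lhs => rw [← hA.apply_inverse s, hA.1, hA.apply_inverse]

lemma PosDefOp.inverse_nonneg {A : DualOp E} (hA : PosDefOp A) (s : StrongDual ℝ E) :
    0 ≤ s (A.inverse s) := by
  have h := hA.nonneg (A.inverse s)
  rwa [hA.apply_inverse] at h

/-- Inversion reverses the order. With v = B⁻¹s, expand ⟨A(v - cA⁻¹s), v - cA⁻¹s⟩ ≥ 0 and bound ⟨Av,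
v⟩ by c⟨s, v⟩. -/
lemma PosDefOp.inverse_le {A B : DualOp E} (hA : PosDefOp A) (hB : PosDefOp B) {c : ℝ} (hc : 0 < c)
    (h : ∀ x, A x x ≤ c * B x x) (s : StrongDual ℝ E) :
    s (B.inverse s) ≤ c * s (A.inverse s) := by
  have h₁ := hA.nonneg (B.inverse s - c • A.inverse s)
  rw [apply_sub_smul_self hA.1, hA.1 (B.inverse s) (A.inverse s), hA.apply_inverse] at h₁
  have h₂ := h (B.inverse s)
  rw [hB.apply_inverse] at h₂
  have h₃ : 0 ≤ c * (c * s (A.inverse s) - s (B.inverse s)) := by nlinarith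
  linarith [nonneg_of_mul_nonneg_right h₃ hc]

/-- Cauchy–Schwarz inequality between `G` and `G⁻¹`. -/
lemma PosDefOp.sq_apply_le {G : DualOp E} (hG : PosDefOp G) (s : StrongDual ℝ E) (u : E) :
    s u ^ 2 ≤ s (G.inverse s) * G u u := by
  have h := hG.cauchy_schwarz (G.inverse s) u
  rwa [hG.apply_inverse] at h

/-- If the eigenvalues of `G` relative to `A` lie between `1 / (1 + ρ)` and `1 / (1 - ρ)`, then
`I - A G⁻¹` contracts the conjugate norm of `A` with factor `ρ`. -/
lemma PosDefOp.residual_le {A G : DualOp E} (hA : PosDefOp A) (hG : PosDefOp G) {ρ : ℝ} (hρ : 0 < ρ)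
    (h₁ : ∀ s : StrongDual ℝ E, s (G.inverse s) ≤ (1 + ρ) * s (A.inverse s))
    (h₂ : ∀ s : StrongDual ℝ E, (1 - ρ) * s (A.inverse s) ≤ s (G.inverse s))
    (s : StrongDual ℝ E) :
    (s - A (G.inverse s)) (A.inverse (s - A (G.inverse s))) ≤ ρ ^ 2 * s (A.inverse s) := by
  set e := s - A (G.inverse s) with he
  have hAe : A.inverse e = A.inverse s - G.inverse s := by
    rw [he, map_sub, hA.inverse_apply]
  have hN : e (A.inverse e) = e (A.inverse s) - e (G.inverse s) := by rw [hAe, map_sub]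
  -- Polarization: N = A⁻¹ - G⁻¹ lies between ±ρA⁻¹ and N(s, e) = ⟨e, A⁻¹e⟩. Testing at s ± ρ⁻¹e
  -- isolates N(s, e), and ρ⁻¹ is the scaling that balances s and e.
  have k₁ := h₂ (s + ρ⁻¹ • e)
  have k₂ := h₁ (s - ρ⁻¹ • e)
  simp only [map_add, map_sub, map_smul, add_apply,
    sub_apply, smul_apply, smul_eq_mul,
    hA.inverse_symm s e, hG.inverse_symm s e] at k₁ k₂
  have h3 : e (G.inverse s) = e (A.inverse s) - e (A.inverse e) := by rw [hN]; ring
  rw [h3] at k₁ k₂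
  have h4 : 0 ≤ 2 * ρ * s (A.inverse s) + 2 * ρ * (ρ⁻¹ * (ρ⁻¹ * e (A.inverse e)))
      - 4 * (ρ⁻¹ * e (A.inverse e)) := by linarith
  have h5 : 2 * ρ * s (A.inverse s) + 2 * ρ * (ρ⁻¹ * (ρ⁻¹ * e (A.inverse e)))
      - 4 * (ρ⁻¹ * e (A.inverse e)) = 2 * ρ⁻¹ * (ρ ^ 2 * s (A.inverse s) - e (A.inverse e)) := by
    field_simp
    ring
  rw [h5] at h4
  linarith [nonneg_of_mul_nonneg_right h4 (by positivity)]

end Operators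

/-! ### Relative traces and their monotonicity -/

section Trace

variable {E : Type*} [NormedAddCommGroup E] [NormedSpace ℝ E] [FiniteDimensional ℝ E]

/-- The trace of `A⁻¹ G`. -/
noncomputable def relTrace (A G : DualOp E) : ℝ :=
  LinearMap.trace ℝ E (A.inverse ∘L G : E →L[ℝ] E)

/-- In an A-orthogonal basis the diagonal entries of an operator are Rayleigh quotients, so
inequalities between quadratic forms pass to traces term by term. -/
lemma PosDefOp.exists_basis_trace {A : DualOp E} (hA : PosDefOp A) :
    ∃ v : Module.Basis (Fin (Module.finrank ℝ E)) ℝ E, (∀ i, 0 < A (v i) (v i)) ∧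
      ∀ T : E →ₗ[ℝ] E, LinearMap.trace ℝ E T = ∑ i, A (v i) (T (v i)) / A (v i) (v i) := by
  let B : LinearMap.BilinForm ℝ E :=
    LinearMap.mk₂ ℝ (fun x y => A x y) (by simp) (by simp) (by simp) (by simp)
  obtain ⟨v, hv⟩ := LinearMap.BilinForm.exists_orthogonal_basis (B := B)
    ⟨fun x y => by simpa [B] using hA.1 x y⟩
  have hpos : ∀ i, 0 < A (v i) (v i) := fun i => hA.2 _ (v.ne_zero i)
  have hort : ∀ i j, i ≠ j → A (v i) (v j) = 0 := fun i j hij => by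
    have := LinearMap.isOrthoᵢ_def.1 hv i j hij
    simpa [B] using this
  refine ⟨v, hpos, fun T => ?_⟩
  rw [LinearMap.trace_eq_matrix_trace ℝ v, Matrix.trace]
  refine Finset.sum_congr rfl fun i _ => ?_
  rw [Matrix.diag_apply, LinearMap.toMatrix_apply, eq_div_iff (hpos i).ne']
  conv_rhs => rw [← v.sum_repr (T (v i))]
  rw [map_sum, Finset.sum_eq_single i]
  · simp
  · intro j _ hj
    simp [hort i j hj.symm]
  · simp

lemma relTrace_self {A : DualOp E} (hA : PosDefOp A) : relTrace A A = Module.finrank ℝ E := by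
  have h : ((A.inverse ∘L A : E →L[ℝ] E) : E →ₗ[ℝ] E) = LinearMap.id := by
    ext x
    simp [hA.inverse_apply]
  rw [relTrace, h, LinearMap.trace_id]

lemma relTrace_le_right {A G G' : DualOp E} (hA : PosDefOp A) {c : ℝ}
    (h : ∀ x, G x x ≤ c * G' x x) : relTrace A G ≤ c * relTrace A G' := by
  obtain ⟨v, hv, hT⟩ := hA.exists_basis_trace
  rw [relTrace, relTrace, hT, hT, Finset.mul_sum]
  refine Finset.sum_le_sum fun i _ => ?_
  rw [← mul_div_assoc]
  refine div_le_div_of_nonneg_right ?_ (hv i).le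
  have key : ∀ K : DualOp E, A (v i) (A.inverse (K (v i))) = K (v i) (v i) := fun K => by
    rw [hA.1, hA.apply_inverse]
  simpa [key] using h (v i)

lemma relTrace_le_left {A A' G : DualOp E} (hA : PosDefOp A) (hA' : PosDefOp A')
    (hG : PosDefOp G) {c : ℝ} (hc : 0 < c)
    (h : ∀ x, A x x ≤ c * A' x x) : relTrace A' G ≤ c * relTrace A G := by
  -- A basis orthogonal for G, not A: the entries become ⟨s, A⁻¹s⟩ with s = Gv, to which order
  -- reversal applies.
  obtain ⟨v, hv, hT⟩ := hG.exists_basis_trace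
  rw [relTrace, relTrace, hT, hT, Finset.mul_sum]
  refine Finset.sum_le_sum fun i _ => ?_
  rw [← mul_div_assoc]
  refine div_le_div_of_nonneg_right ?_ (hv i).le
  simpa using hA.inverse_le hA' hc h (G (v i))

end Trace

/-! ### The Broyden class: order bounds, traces, decrease of the potential -/

section Updates

variable {E : Type*} [NormedAddCommGroup E] [NormedSpace ℝ E]

lemma outer_apply (u : E) (s : StrongDual ℝ E) : outer u s = s u • u := by
  simp [outer]

lemma DFP_apply (A G : DualOp E) (u x : E) :
    DFP A G u x = G x - (A u u)⁻¹ • (G x u • A u + A x u • G u)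
      + ((G u u / A u u + 1) * (A u u)⁻¹ * A x u) • A u := by
  simp [DFP, outer_apply, smul_smul]

lemma BFGS_apply (A G : DualOp E) (u x : E) :
    BFGS A G u x = G x - ((G u u)⁻¹ * G x u) • G u + ((A u u)⁻¹ * A x u) • A u := by
  simp [BFGS, outer_apply, smul_smul]

lemma Broyd_zero (φ : ℝ) (A G : DualOp E) : Broyd φ A G 0 = G := by
  simp [Broyd]

lemma Broyd_of_ne_zero (φ : ℝ) (A G : DualOp E) {u : E} (hu : u ≠ 0) :
    Broyd φ A G u = φ • DFP A G u + (1 - φ) • BFGS A G u := by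
  simp [Broyd, hu]

variable {A G : DualOp E}

lemma DFP_symm (hA : ∀ x y, A x y = A y x) (hG : ∀ x y, G x y = G y x) (u x y : E) :
    DFP A G u x y = DFP A G u y x := by
  simp only [DFP_apply, add_apply, sub_apply, smul_apply, smul_eq_mul, hG x y, hA u x, hA u y,
    hG u x, hG u y]
  ring

lemma BFGS_symm (hA : ∀ x y, A x y = A y x) (hG : ∀ x y, G x y = G y x) (u x y : E) :
    BFGS A G u x y = BFGS A G u y x := by
  simp only [BFGS_apply, add_apply, sub_apply, smul_apply, smul_eq_mul, hG x y, hA u x, hA u y,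
    hG u x, hG u y]
  ring

lemma Broyd_symm (hA : ∀ x y, A x y = A y x) (hG : ∀ x y, G x y = G y x) (φ : ℝ) (u x y : E) :
    Broyd φ A G u x y = Broyd φ A G u y x := by
  rcases eq_or_ne u 0 with rfl | hu
  · rw [Broyd_zero, hG]
  · rw [Broyd_of_ne_zero _ _ _ hu]
    simp [DFP_symm hA hG u x y, BFGS_symm hA hG u x y]

/-- Both updates evaluate G on x with its component along u removed: A-orthogonally here,
G-orthogonally for BFGS. All order properties follow from this form. -/
lemma DFP_apply_self (hA : PosDefOp A) (hG : PosDefOp G) {u : E} (hu : u ≠ 0) (x : E) :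
    DFP A G u x x = G (x - (A x u / A u u) • u) (x - (A x u / A u u) • u)
      + (A x u) ^ 2 / A u u := by
  have ha := (hA.2 u hu).ne'
  rw [apply_sub_smul_self hG.1]
  simp only [DFP_apply, add_apply, sub_apply, smul_apply, smul_eq_mul, hA.1 u x, hG.1 u x]
  field_simp
  ring

lemma BFGS_apply_self (hA : PosDefOp A) (hG : PosDefOp G) {u : E} (hu : u ≠ 0) (x : E) :
    BFGS A G u x x = G (x - (G x u / G u u) • u) (x - (G x u / G u u) • u)
      + (A x u) ^ 2 / A u u := by
  have ha := (hA.2 u hu).ne'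
  have hg := (hG.2 u hu).ne'
  rw [apply_sub_smul_self hG.1]
  simp only [BFGS_apply, add_apply, sub_apply, smul_apply, smul_eq_mul, hA.1 u x, hG.1 u x]
  field_simp
  ring

/-- Completing the square: the component along `u` can only be removed at a profit. -/
lemma PosDefOp.apply_self_sub_le (hA : PosDefOp A) {u : E} (hu : u ≠ 0) (x : E) (t : ℝ) :
    A x x - A x u ^ 2 / A u u ≤ A (x - t • u) (x - t • u) := by
  have ha := hA.2 u hu
  have h : A (x - t • u) (x - t • u) - (A x x - A x u ^ 2 / A u u)
      = (t * A u u - A x u) ^ 2 / A u u := by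
    rw [apply_sub_smul_self hA.1]
    field_simp
    ring
  have h' : 0 ≤ (t * A u u - A x u) ^ 2 / A u u := by positivity
  linarith

lemma PosDefOp.apply_self_proj (hA : PosDefOp A) {u : E} (hu : u ≠ 0) (x : E) :
    A (x - (A x u / A u u) • u) (x - (A x u / A u u) • u) = A x x - A x u ^ 2 / A u u := by
  have ha := (hA.2 u hu).ne'
  rw [apply_sub_smul_self hA.1]
  field_simp
  ring

/-- The G-orthogonal projection minimises the G-length of x - tu over t. -/
lemma BFGS_le_DFP (hA : PosDefOp A) (hG : PosDefOp G) {u : E} (hu : u ≠ 0) (x : E) :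
    BFGS A G u x x ≤ DFP A G u x x := by
  rw [BFGS_apply_self hA hG hu, DFP_apply_self hA hG hu, hG.apply_self_proj hu]
  linarith [hG.apply_self_sub_le hu x (A x u / A u u)]

/-- Removing the A-component along u lowers the bound by η(A x u)²/(A u u), while the added term is
only (A x u)²/(A u u); this is where 1 ≤ η enters. -/
lemma DFP_le (hA : PosDefOp A) (hG : PosDefOp G) {η : ℝ} (hη : 1 ≤ η)
    (h : ∀ x, G x x ≤ η * A x x) {u : E} (hu : u ≠ 0) (x : E) :
    DFP A G u x x ≤ η * A x x := by
  have ha := hA.2 u hu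
  have h₁ := h (x - (A x u / A u u) • u)
  rw [hA.apply_self_proj hu] at h₁
  rw [DFP_apply_self hA hG hu]
  have h₂ : 0 ≤ A x u ^ 2 / A u u := by positivity
  nlinarith

lemma le_BFGS (hA : PosDefOp A) (hG : PosDefOp G) {ξ : ℝ} (hξ : 1 ≤ ξ)
    (h : ∀ x, A x x ≤ ξ * G x x) {u : E} (hu : u ≠ 0) (x : E) :
    A x x ≤ ξ * BFGS A G u x x := by
  have ha := hA.2 u hu
  have h₁ := h (x - (G x u / G u u) • u)
  have h₃ := hA.apply_self_sub_le hu x (G x u / G u u)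
  rw [BFGS_apply_self hA hG hu]
  have h₂ : 0 ≤ A x u ^ 2 / A u u := by positivity
  nlinarith

lemma BFGS_le_Broyd (hA : PosDefOp A) (hG : PosDefOp G) {φ : ℝ} (hφ : φ ∈ Set.Icc (0 : ℝ) 1)
    {u : E} (hu : u ≠ 0) (x : E) : BFGS A G u x x ≤ Broyd φ A G u x x := by
  have h := BFGS_le_DFP hA hG hu x
  rw [Broyd_of_ne_zero _ _ _ hu]
  simp only [add_apply, smul_apply, smul_eq_mul]
  nlinarith [hφ.1]

lemma Broyd_le_DFP (hA : PosDefOp A) (hG : PosDefOp G) {φ : ℝ} (hφ : φ ∈ Set.Icc (0 : ℝ) 1)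
    {u : E} (hu : u ≠ 0) (x : E) : Broyd φ A G u x x ≤ DFP A G u x x := by
  have h := BFGS_le_DFP hA hG hu x
  rw [Broyd_of_ne_zero _ _ _ hu]
  simp only [add_apply, smul_apply, smul_eq_mul]
  nlinarith [hφ.2]

lemma Broyd_le (hA : PosDefOp A) (hG : PosDefOp G) {φ : ℝ} (hφ : φ ∈ Set.Icc (0 : ℝ) 1)
    {η : ℝ} (hη : 1 ≤ η) (h : ∀ x, G x x ≤ η * A x x) (u x : E) :
    Broyd φ A G u x x ≤ η * A x x := by
  rcases eq_or_ne u 0 with rfl | hu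
  · rw [Broyd_zero]
    exact h x
  · exact (Broyd_le_DFP hA hG hφ hu x).trans (DFP_le hA hG hη h hu x)

lemma le_Broyd (hA : PosDefOp A) (hG : PosDefOp G) {φ : ℝ} (hφ : φ ∈ Set.Icc (0 : ℝ) 1)
    {ξ : ℝ} (hξ : 1 ≤ ξ) (h : ∀ x, A x x ≤ ξ * G x x) (u x : E) :
    A x x ≤ ξ * Broyd φ A G u x x := by
  rcases eq_or_ne u 0 with rfl | hu
  · rw [Broyd_zero]
    exact h x
  · exact (le_BFGS hA hG hξ h hu x).trans
      (mul_le_mul_of_nonneg_left (BFGS_le_Broyd hA hG hφ hu x) (by linarith))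

lemma BFGS_posDef (hA : PosDefOp A) (hG : PosDefOp G) {u : E} (hu : u ≠ 0) :
    PosDefOp (BFGS A G u) := by
  refine ⟨BFGS_symm hA.1 hG.1 u, fun x hx => ?_⟩
  rw [BFGS_apply_self hA hG hu]
  have ha := hA.2 u hu
  by_cases hv : x - (G x u / G u u) • u = 0
  · obtain ⟨t, rfl⟩ : ∃ t : ℝ, x = t • u := ⟨_, sub_eq_zero.1 hv⟩
    have ht : t ≠ 0 := fun h => hx (by simp [h])
    rw [hv]
    simp only [map_zero, map_smul, smul_apply, smul_eq_mul, zero_add]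
    positivity
  · have := hG.2 _ hv
    positivity

lemma Broyd_posDef (hA : PosDefOp A) (hG : PosDefOp G) {φ : ℝ} (hφ : φ ∈ Set.Icc (0 : ℝ) 1)
    (u : E) : PosDefOp (Broyd φ A G u) := by
  rcases eq_or_ne u 0 with rfl | hu
  · rwa [Broyd_zero]
  · exact ⟨Broyd_symm hA.1 hG.1 φ u, fun x hx =>
      ((BFGS_posDef hA hG hu).2 x hx).trans_le (BFGS_le_Broyd hA hG hφ hu x)⟩

variable [FiniteDimensional ℝ E]

/-- The inverse BFGS formula, checked by applying the update to the candidate. Its deviation from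
G⁻¹A is a sum of rank-one terms, so the trace can be read off. -/
lemma BFGS_inverse_apply (hA : PosDefOp A) (hG : PosDefOp G) {u : E} (hu : u ≠ 0) (x : E) :
    (BFGS A G u).inverse (A x) =
      G.inverse (A x) - (A x u / A u u) • G.inverse (A u)
        - ((A u (G.inverse (A x)) - A x u / A u u * A u (G.inverse (A u))) / A u u) • u
        + (A x u / A u u) • u := by
  have ha := (hA.2 u hu).ne'
  have hg := (hG.2 u hu).ne'
  refine (BFGS_posDef hA hG hu).inverse_eq_of_apply_eq ?_
  rw [BFGS_apply]
  simp only [map_add, map_sub, map_smul, add_apply, sub_apply, smul_apply, smul_eq_mul,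
    hG.apply_inverse, hA.1 (G.inverse (A x)) u, hA.1 (G.inverse (A u)) u]
  ext y
  simp only [add_apply, sub_apply, smul_apply, smul_eq_mul]
  field_simp
  ring

lemma relTrace_BFGS_left (hA : PosDefOp A) (hG : PosDefOp G) {u : E} (hu : u ≠ 0) :
    relTrace (BFGS A G u) A = relTrace G A + 1 - A u (G.inverse (A u)) / A u u := by
  have ha := (hA.2 u hu).ne'
  have h : (((BFGS A G u).inverse ∘L A : E →L[ℝ] E) : E →ₗ[ℝ] E)
      = (G.inverse ∘L A : E →L[ℝ] E)
        - (A u u)⁻¹ • ((A u : E →ₗ[ℝ] ℝ).smulRight (G.inverse (A u)))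
        - (A u u)⁻¹ • (((A (G.inverse (A u)) : StrongDual ℝ E) : E →ₗ[ℝ] ℝ).smulRight u)
        + ((A u (G.inverse (A u)) / A u u + 1) * (A u u)⁻¹) •
            ((A u : E →ₗ[ℝ] ℝ).smulRight u) := by
    ext x
    have h₁ : A u (G.inverse (A x)) = A (G.inverse (A u)) x := by
      rw [hG.inverse_symm, hA.1]
    simp only [ContinuousLinearMap.coe_coe, ContinuousLinearMap.comp_apply,
      LinearMap.add_apply, LinearMap.sub_apply, LinearMap.smul_apply, LinearMap.smulRight_apply,
      BFGS_inverse_apply hA hG hu, hA.1 x u, h₁]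
    module
  rw [relTrace, h, map_add, map_sub, map_sub, map_smul, map_smul, map_smul,
    LinearMap.trace_smulRight, LinearMap.trace_smulRight, LinearMap.trace_smulRight, ← relTrace]
  simp only [ContinuousLinearMap.coe_coe, smul_eq_mul, hA.1 (G.inverse (A u)) u]
  field_simp
  ring

lemma relTrace_DFP_right (hA : PosDefOp A) (hG : PosDefOp G) {u : E} (hu : u ≠ 0) :
    relTrace A (DFP A G u) = relTrace A G + 1 - G u u / A u u := by
  have ha := (hA.2 u hu).ne'
  have h : ((A.inverse ∘L DFP A G u : E →L[ℝ] E) : E →ₗ[ℝ] E)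
      = (A.inverse ∘L G : E →L[ℝ] E)
        - (A u u)⁻¹ • ((G u : E →ₗ[ℝ] ℝ).smulRight u)
        - (A u u)⁻¹ • ((A u : E →ₗ[ℝ] ℝ).smulRight (A.inverse (G u)))
        + ((G u u / A u u + 1) * (A u u)⁻¹) • ((A u : E →ₗ[ℝ] ℝ).smulRight u) := by
    ext x
    simp only [ContinuousLinearMap.coe_coe, ContinuousLinearMap.comp_apply,
      LinearMap.add_apply, LinearMap.sub_apply, LinearMap.smul_apply, LinearMap.smulRight_apply,
      DFP_apply, map_add, map_sub, map_smul, hA.inverse_apply, hA.1 x u, hG.1 x u]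
    module
  rw [relTrace, h, map_add, map_sub, map_sub, map_smul, map_smul, map_smul,
    LinearMap.trace_smulRight, LinearMap.trace_smulRight, LinearMap.trace_smulRight, ← relTrace]
  have h₁ : A u (A.inverse (G u)) = G u u := by rw [hA.1, hA.apply_inverse]
  simp only [ContinuousLinearMap.coe_coe, smul_eq_mul, h₁]
  field_simp
  ring

lemma relTrace_BFGS_right (hA : PosDefOp A) (hG : PosDefOp G) {u : E} (hu : u ≠ 0) :
    relTrace A (BFGS A G u) = relTrace A G + 1 - G u (A.inverse (G u)) / G u u := by
  have ha := (hA.2 u hu).ne'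
  have hg := (hG.2 u hu).ne'
  have h : ((A.inverse ∘L BFGS A G u : E →L[ℝ] E) : E →ₗ[ℝ] E)
      = (A.inverse ∘L G : E →L[ℝ] E)
        - (G u u)⁻¹ • ((G u : E →ₗ[ℝ] ℝ).smulRight (A.inverse (G u)))
        + (A u u)⁻¹ • ((A u : E →ₗ[ℝ] ℝ).smulRight u) := by
    ext x
    simp only [ContinuousLinearMap.coe_coe, ContinuousLinearMap.comp_apply,
      LinearMap.add_apply, LinearMap.sub_apply, LinearMap.smul_apply, LinearMap.smulRight_apply,
      BFGS_apply, map_add, map_sub, map_smul, hA.inverse_apply, hA.1 x u, hG.1 x u]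
    module
  rw [relTrace, h, map_add, map_sub, map_smul, map_smul,
    LinearMap.trace_smulRight, LinearMap.trace_smulRight, ← relTrace]
  simp only [ContinuousLinearMap.coe_coe, smul_eq_mul]
  field_simp
  ring

lemma relTrace_Broyd_right (hA : PosDefOp A) (hG : PosDefOp G) (φ : ℝ) {u : E} (hu : u ≠ 0) :
    relTrace A (Broyd φ A G u) = relTrace A G + 1
      - (φ * (G u u / A u u) + (1 - φ) * (G u (A.inverse (G u)) / G u u)) := by
  have h : relTrace A (Broyd φ A G u)
      = φ * relTrace A (DFP A G u) + (1 - φ) * relTrace A (BFGS A G u) := by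
    rw [Broyd_of_ne_zero _ _ _ hu, relTrace, relTrace, relTrace, ← smul_eq_mul, ← smul_eq_mul,
      ← map_smul, ← map_smul, ← map_add]
    congr 1
    ext x
    simp
  rw [h, relTrace_DFP_right hA hG hu, relTrace_BFGS_right hA hG hu]
  ring

/-- The squared relative length, in the conjugate norm of `A`, of the residual `(G - A) u`. -/
noncomputable def residualRatio (A G : DualOp E) (u : E) : ℝ :=
  (G u - A u) (A.inverse (G u - A u)) / G u (A.inverse (G u))

lemma residual_eq (hA : PosDefOp A) (G : DualOp E) (u : E) :
    (G u - A u) (A.inverse (G u - A u)) = G u (A.inverse (G u)) - 2 * G u u + A u u := by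
  have h₁ : A u (A.inverse (G u)) = G u u := by rw [hA.1, hA.apply_inverse]
  simp only [map_sub, sub_apply, hA.inverse_apply, h₁]
  ring

lemma residualRatio_nonneg (hA : PosDefOp A) (G : DualOp E) (u : E) : 0 ≤ residualRatio A G u :=
  div_nonneg (hA.inverse_nonneg _) (hA.inverse_nonneg _)

/-- The symmetric potential `tr (A⁻¹ G) + tr (G⁻¹ A)` decreases under an update of the convex
Broyden class by a multiple of the squared residual ratio. -/
lemma relTrace_Broyd_add_le (hA : PosDefOp A) (hG : PosDefOp G) {φ : ℝ}
    (hφ : φ ∈ Set.Icc (0 : ℝ) 1) {X κ : ℝ} (hX : 1 ≤ X) (hκ : 0 < κ)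
    (h₁ : ∀ x, A x x ≤ X * G x x) (h₂ : ∀ x, κ * G x x ≤ X * A x x) (u : E) :
    relTrace A (Broyd φ A G u) + relTrace (Broyd φ A G u) A
        + (φ * κ + 1 - φ) * residualRatio A G u / X ^ 3
      ≤ relTrace A G + relTrace G A := by
  rcases eq_or_ne u 0 with rfl | hu
  · simp [Broyd_zero, residualRatio]
  have hX0 : 0 < X := by linarith
  have ha := hA.2 u hu
  have hg := hG.2 u hu
  have hp : G u u ^ 2 ≤ G u (A.inverse (G u)) * A u u := hA.sq_apply_le (G u) u
  have hq : A u u ^ 2 ≤ A u (G.inverse (A u)) * G u u := hG.sq_apply_le (A u) u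
  have hT₁ := relTrace_Broyd_right hA hG φ hu
  -- The full Broyden update dominates BFGS, so its inverse is smaller; an explicit inverse is
  -- needed for BFGS only.
  have hT₂ : relTrace (Broyd φ A G u) A ≤ relTrace G A + 1 - A u (G.inverse (A u)) / A u u := by
    rw [← relTrace_BFGS_left hA hG hu, ← one_mul (relTrace (BFGS A G u) A)]
    exact relTrace_le_left (BFGS_posDef hA hG hu) (Broyd_posDef hA hG hφ u) hA one_pos
      (fun x => by rw [one_mul]; exact BFGS_le_Broyd hA hG hφ hu x)
  have hres := residual_eq hA G u
  have hres₀ := hA.inverse_nonneg (G u - A u)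
  -- The right side contains ⟨(G - A)u, G⁻¹(G - A)u⟩; since κG ⪯ XA, it controls the same residual
  -- measured with A⁻¹.
  have hres' : κ * (G u (A.inverse (G u)) - 2 * G u u + A u u)
      ≤ X * (G u u - 2 * A u u + A u (G.inverse (A u))) := by
    have h₃ : ∀ x, G x x ≤ (X / κ) * A x x := fun x => by
      rw [div_mul_eq_mul_div, le_div_iff₀ hκ, mul_comm]
      exact h₂ x
    have h := hG.inverse_le hA (div_pos hX0 hκ) h₃ (G u - A u)
    rw [hres, div_mul_eq_mul_div, le_div_iff₀ hκ] at h
    have h₄ : G u (G.inverse (A u)) = A u u := by rw [hG.1, hG.apply_inverse]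
    simp only [map_sub, sub_apply, hG.inverse_apply, h₄] at h
    linarith
  have h₁u := h₁ u
  rw [residualRatio, hres]
  rw [hres] at hres₀
  generalize A u u = a at *
  generalize G u u = g at *
  generalize G u (A.inverse (G u)) = p at *
  generalize A u (G.inverse (A u)) = q at *
  have hp0 : 0 < p := pos_of_mul_pos_left ((by positivity : 0 < g ^ 2).trans_le hp) ha.le
  have hpg : g ≤ X * p := by
    have : g * g ≤ (X * p) * g := by nlinarith
    exact le_of_mul_le_mul_right this hg
  have hpa : a ≤ X ^ 2 * p := by nlinarith
  -- DFP share of the decrease: κ/X comes from changing the norm of the residual, 1/X² from a ≤ X²p.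
  -- This case dictates the exponent 3.
  have hD : κ * ((p - 2 * g + a) / p / X ^ 3) ≤ g / a - 1 + (q / a - 1) := by
    have e₁ : g / a - 1 + (q / a - 1) = (g - 2 * a + q) / a := by
      field_simp
      ring
    have e₂ : κ * ((p - 2 * g + a) / p / X ^ 3)
        = (κ * (p - 2 * g + a) / X) / (X ^ 2 * p) := by field_simp
    rw [e₁, e₂]
    have e₃ : κ * (p - 2 * g + a) / X ≤ g - 2 * a + q := by
      rw [div_le_iff₀ hX0]
      linarith
    have e₄ : 0 ≤ κ * (p - 2 * g + a) / X := by positivity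
    exact div_le_div₀ (e₄.trans e₃) e₃ ha hpa
  -- BFGS share: Cauchy–Schwarz gives q/a ≥ a/g, so the decrease is at least the residual over g,
  -- without the loss κ.
  have hB : (p - 2 * g + a) / p / X ^ 3 ≤ p / g - 1 + (q / a - 1) := by
    have e₁ : a / g ≤ q / a := by
      rw [div_le_div_iff₀ hg ha]
      linarith
    have e₂ : (p - 2 * g + a) / g = p / g - 1 + (a / g - 1) := by
      field_simp
      ring
    have e₃ : (p - 2 * g + a) / p / X ^ 3 ≤ (p - 2 * g + a) / g := by
      rw [div_div]
      refine div_le_div_of_nonneg_left hres₀ hg (hpg.trans ?_)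
      rw [mul_comm]
      exact mul_le_mul_of_nonneg_left (le_self_pow₀ hX (by norm_num)) hp0.le
    linarith
  have hD' := mul_le_mul_of_nonneg_left hD hφ.1
  have hB' := mul_le_mul_of_nonneg_left hB (sub_nonneg.2 hφ.2)
  have e : (φ * κ + 1 - φ) * ((p - 2 * g + a) / p) / X ^ 3
      = φ * (κ * ((p - 2 * g + a) / p / X ^ 3)) + (1 - φ) * ((p - 2 * g + a) / p / X ^ 3) := by
    ring
  rw [e, hT₁]
  linarith

end Updates

/-! ### Averages of relatively Lipschitz functions -/

section Averages

open intervalIntegral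

lemma integral_id_mul_const (c : ℝ) : ∫ t in (0 : ℝ)..1, t * c = c / 2 := by
  rw [intervalIntegral.integral_mul_const, integral_id]
  ring

/-- Comparison of a function with its average over `[0, 1]`, under a relative Lipschitz
condition. -/
lemma average_bounds_zero {g : ℝ → ℝ} (hg : Continuous g) {c : ℝ}
    (h : ∀ s t w, g t ≤ g s + c * |t - s| * g w) :
    ∫ t in (0 : ℝ)..1, g t ≤ (1 + c / 2) * g 0 ∧ g 0 ≤ (1 + c / 2) * ∫ t in (0 : ℝ)..1, g t := by
  have hi : ∀ a b, IntervalIntegrable g MeasureTheory.volume a b := fun a b =>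
    hg.intervalIntegrable a b
  constructor
  · have h₁ : ∫ t in (0 : ℝ)..1, g t ≤ ∫ t in (0 : ℝ)..1, (g 0 + t * (c * g 0)) := by
      refine integral_mono_on zero_le_one (hi _ _)
        (Continuous.intervalIntegrable (by fun_prop) _ _) fun t ht => ?_
      have := h 0 t 0
      rw [sub_zero, abs_of_nonneg ht.1] at this
      linarith
    rw [integral_add (by simp) (Continuous.intervalIntegrable (by fun_prop) _ _),
      integral_id_mul_const, integral_const] at h₁
    simp only [sub_zero, one_smul] at h₁
    linarith
  · set J := ∫ t in (0 : ℝ)..1, g t with hJ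
    -- The free point w is averaged first, which puts the mean J itself in the error term; averaging
    -- over t then gives c/2.
    have h₁ : ∀ t ∈ Set.Icc (0 : ℝ) 1, g 0 - t * (c * J) ≤ g t := fun t ht => by
      have h₂ : ∫ _s in (0 : ℝ)..1, (g 0 - g t) ≤ ∫ s in (0 : ℝ)..1, (c * t) * g s := by
        refine integral_mono_on zero_le_one (by simp)
          (Continuous.intervalIntegrable (by fun_prop) _ _) fun s _ => ?_
        have := h t 0 s
        rw [zero_sub, abs_neg, abs_of_nonneg ht.1] at this
        linarith
      rw [integral_const, intervalIntegral.integral_const_mul, ← hJ] at h₂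
      simp only [sub_zero, one_smul] at h₂
      linarith
    have h₃ : ∫ t in (0 : ℝ)..1, (g 0 - t * (c * J)) ≤ J :=
      integral_mono_on zero_le_one (Continuous.intervalIntegrable (by fun_prop) _ _) (hi _ _) h₁
    rw [integral_sub (by simp) (Continuous.intervalIntegrable (by fun_prop) _ _),
      integral_id_mul_const, integral_const] at h₃
    simp only [sub_zero, one_smul] at h₃
    linarith

lemma average_bounds_one {g : ℝ → ℝ} (hg : Continuous g) {c : ℝ}
    (h : ∀ s t w, g t ≤ g s + c * |t - s| * g w) :
    ∫ t in (0 : ℝ)..1, g t ≤ (1 + c / 2) * g 1 ∧ g 1 ≤ (1 + c / 2) * ∫ t in (0 : ℝ)..1, g t := by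
  have key := average_bounds_zero (g := fun t => g (1 - t)) (by fun_prop) (c := c)
    (fun s t w => by
      have := h (1 - s) (1 - t) (1 - w)
      rwa [show 1 - t - (1 - s) = -(t - s) by ring, abs_neg] at this)
  simpa using key

end Averages

/-! ### Hessians and integral Hessians under strong self-concordance -/

section Hessian

variable {E : Type*} [NormedAddCommGroup E] [NormedSpace ℝ E]

/-- The standing assumptions on the objective function. -/
structure IsAdmissible (f : E → ℝ) (B : DualOp E) (μ L M : ℝ) : Prop where
  diff : Differentiable ℝ f
  diff' : Differentiable ℝ (fderiv ℝ f)
  posDef : PosDefOp B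
  mu_pos : 0 < μ
  L_pos : 0 < L
  M_nonneg : 0 ≤ M
  convex : ∀ y, OpLE (μ • B) (hess f y)
  smooth : ∀ y, OpLE (hess f y) (L • B)
  concordant : StronglySelfConcordant f M

variable {f : E → ℝ} {B : DualOp E} {μ L M : ℝ}

namespace IsAdmissible

lemma mu_le_hess (h : IsAdmissible f B μ L M) (y v : E) : μ * B v v ≤ hess f y v v := by
  simpa using opLE_iff.1 (h.convex y) v

lemma hess_le_L (h : IsAdmissible f B μ L M) (y v : E) : hess f y v v ≤ L * B v v := by
  simpa using opLE_iff.1 (h.smooth y) v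

lemma mu_le_L [Nontrivial E] (h : IsAdmissible f B μ L M) : μ ≤ L := by
  obtain ⟨v, hv⟩ := exists_ne (0 : E)
  exact le_of_mul_le_mul_right ((h.mu_le_hess 0 v).trans (h.hess_le_L 0 v)) (h.posDef.2 v hv)

lemma hess_symm (h : IsAdmissible f B μ L M) (y v w : E) : hess f y v w = hess f y w v :=
  second_derivative_symmetric (fun z => (h.diff z).hasFDerivAt) (h.diff' y).hasFDerivAt v w

lemma hess_posDef (h : IsAdmissible f B μ L M) (y : E) : PosDefOp (hess f y) :=
  ⟨h.hess_symm y, fun v hv => (mul_pos h.mu_pos (h.posDef.2 v hv)).trans_le (h.mu_le_hess y v)⟩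

lemma hess_le_hess_add (h : IsAdmissible f B μ L M) (x y z w v : E) :
    hess f y v v ≤ hess f x v v + M * primalNorm (hess f z) (y - x) * hess f w v v := by
  have := opLE_iff.1 (h.concordant x y z w) v
  simp only [sub_apply, smul_apply, smul_eq_mul] at this
  linarith

lemma primalNorm_smul (A : DualOp E) (t : ℝ) (v : E) :
    primalNorm A (t • v) = |t| * primalNorm A v := by
  rw [primalNorm, primalNorm, map_smul, map_smul, smul_apply, smul_eq_mul, smul_eq_mul, ← mul_assoc,
    Real.sqrt_mul (mul_self_nonneg t), Real.sqrt_mul_self_eq_abs]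

lemma primalNorm_neg (A : DualOp E) (v : E) : primalNorm A (-v) = primalNorm A v := by
  simp [primalNorm]

/-- Twice differentiability alone does not make the Hessian continuous; self-concordance does.
Integrability of the Hessian along segments rests on this. -/
lemma continuous_hess_apply_self (h : IsAdmissible f B μ L M) (v : E) :
    Continuous fun y => hess f y v v := by
  rw [continuous_iff_continuousAt]
  intro x
  rw [ContinuousAt, tendsto_iff_dist_tendsto_zero]
  have hlim : Filter.Tendsto
      (fun y => M * primalNorm (hess f 0) (y - x) * hess f 0 v v) (nhds x) (nhds 0) := by
    have hc : Continuous fun y => M * primalNorm (hess f 0) (y - x) * hess f 0 v v := by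
      unfold primalNorm
      fun_prop
    simpa [primalNorm] using hc.tendsto x
  refine squeeze_zero (fun _ => dist_nonneg) (fun y => ?_) hlim
  rw [Real.dist_eq, abs_sub_le_iff]
  constructor
  · linarith [h.hess_le_hess_add x y 0 0 v]
  · have := h.hess_le_hess_add y x 0 0 v
    rw [← neg_sub y x, primalNorm_neg] at this
    linarith

variable [FiniteDimensional ℝ E]

lemma continuous_hess (h : IsAdmissible f B μ L M) : Continuous (hess f) := by
  refine continuous_clm_apply.2 fun v => continuous_clm_apply.2 fun w => ?_
  have e : (fun y => hess f y v w) = fun y =>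
      (hess f y (v + w) (v + w) - hess f y v v - hess f y w w) / 2 := by
    funext y
    simp only [map_add, add_apply, h.hess_symm y w v]
    ring
  rw [e]
  exact (((h.continuous_hess_apply_self _).sub (h.continuous_hess_apply_self _)).sub
    (h.continuous_hess_apply_self _)).div_const 2

lemma continuous_hess_segment (h : IsAdmissible f B μ L M) (x u : E) :
    Continuous fun t : ℝ => hess f (x + t • u) :=
  h.continuous_hess.comp (by fun_prop)

lemma integralHess_apply (h : IsAdmissible f B μ L M) (x u v : E) :
    integralHess f x u v = ∫ t in (0 : ℝ)..1, hess f (x + t • u) v :=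
  ContinuousLinearMap.intervalIntegral_apply
    ((h.continuous_hess_segment x u).intervalIntegrable 0 1) v

lemma integralHess_apply_apply (h : IsAdmissible f B μ L M) (x u v w : E) :
    integralHess f x u v w = ∫ t in (0 : ℝ)..1, hess f (x + t • u) v w := by
  rw [h.integralHess_apply]
  exact ContinuousLinearMap.intervalIntegral_apply
    (((h.continuous_hess_segment x u).clm_apply continuous_const).intervalIntegrable 0 1) w

lemma grad_add (h : IsAdmissible f B μ L M) (x u : E) :
    grad f (x + u) = grad f x + integralHess f x u u := by
  have hderiv : ∀ t : ℝ, HasDerivAt (fun t : ℝ => fderiv ℝ f (x + t • u))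
      (hess f (x + t • u) u) t := fun t => by
    have h₁ : HasDerivAt (fun t : ℝ => x + t • u) u t := by
      simpa using ((hasDerivAt_id t).smul_const u).const_add x
    exact (h.diff' (x + t • u)).hasFDerivAt.comp_hasDerivAt t h₁
  have h₂ := intervalIntegral.integral_eq_sub_of_hasDerivAt (a := 0) (b := 1)
    (fun t _ => hderiv t)
    (((h.continuous_hess_segment x u).clm_apply continuous_const).intervalIntegrable 0 1)
  rw [h.integralHess_apply, h₂]
  simp [grad]

lemma integralHess_symm (h : IsAdmissible f B μ L M) (x u v w : E) :
    integralHess f x u v w = integralHess f x u w v := by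
  rw [h.integralHess_apply_apply, h.integralHess_apply_apply]
  simp only [h.hess_symm _ v w]

/-- The weaker constant exp(c/2) replaces 1 + c/2 so that successive comparisons add in the
exponent. The length is measured at x for both endpoints, since the point z in self-concordance is
free. -/
lemma integralHess_bounds (h : IsAdmissible f B μ L M) (x u v : E) :
    (integralHess f x u v v ≤ Real.exp (M * primalNorm (hess f x) u / 2) * hess f x v v ∧
      hess f x v v ≤ Real.exp (M * primalNorm (hess f x) u / 2) * integralHess f x u v v) ∧
    (integralHess f x u v v ≤ Real.exp (M * primalNorm (hess f x) u / 2) * hess f (x + u) v v ∧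
      hess f (x + u) v v ≤
        Real.exp (M * primalNorm (hess f x) u / 2) * integralHess f x u v v) := by
  set c := M * primalNorm (hess f x) u with hc
  have hlip : ∀ s t w : ℝ, hess f (x + t • u) v v ≤
      hess f (x + s • u) v v + c * |t - s| * hess f (x + w • u) v v := fun s t w => by
    have := h.hess_le_hess_add (x + s • u) (x + t • u) x (x + w • u) v
    rw [add_sub_add_left_eq_sub, ← sub_smul, primalNorm_smul] at this
    rw [hc]
    linarith
  have hcont : Continuous fun t : ℝ => hess f (x + t • u) v v :=
    (h.continuous_hess_apply_self v).comp (by fun_prop)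
  have h₀ := average_bounds_zero hcont hlip
  have h₁ := average_bounds_one hcont hlip
  simp only [← h.integralHess_apply_apply, zero_smul, one_smul, add_zero] at h₀ h₁
  have hexp : 1 + c / 2 ≤ Real.exp (c / 2) := by linarith [Real.add_one_le_exp (c / 2)]
  have hx := (h.hess_posDef x).nonneg v
  have hy := (h.hess_posDef (x + u)).nonneg v
  have hJ : 0 ≤ integralHess f x u v v := by
    rw [h.integralHess_apply_apply]
    exact intervalIntegral.integral_nonneg zero_le_one
      fun t _ => (h.hess_posDef (x + t • u)).nonneg v
  exact ⟨⟨h₀.1.trans (mul_le_mul_of_nonneg_right hexp hx),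
    h₀.2.trans (mul_le_mul_of_nonneg_right hexp hJ)⟩,
    h₁.1.trans (mul_le_mul_of_nonneg_right hexp hy),
    h₁.2.trans (mul_le_mul_of_nonneg_right hexp hJ)⟩

lemma integralHess_posDef (h : IsAdmissible f B μ L M) (x u : E) :
    PosDefOp (integralHess f x u) :=
  (h.hess_posDef x).of_le (h.integralHess_symm x u)
    (fun v => (h.integralHess_bounds x u v).1.2) (Real.exp_pos _)

end IsAdmissible

end Hessian

/-! ### One quasi-Newton step -/

section Step

variable {E : Type*} [NormedAddCommGroup E] [NormedSpace ℝ E]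

/-- `G` is a positive definite approximation of `A`, with `ξ⁻¹ A ⪯ G ⪯ (ξ / κ) A`. -/
structure Approximates (κ ξ : ℝ) (A G : DualOp E) : Prop where
  posDef : PosDefOp G
  lower : ∀ x, A x x ≤ ξ * G x x
  upper : ∀ x, κ * G x x ≤ ξ * A x x

lemma Approximates.change {κ ξ δ : ℝ} {A A' G : DualOp E} (h : Approximates κ ξ A G)
    (hξ : 0 ≤ ξ) (hδ : 0 ≤ δ) (h₁ : ∀ x, A x x ≤ δ * A' x x) (h₂ : ∀ x, A' x x ≤ δ * A x x) :
    Approximates κ (ξ * δ) A' G where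
  posDef := h.posDef
  lower x := by
    have := mul_le_mul_of_nonneg_left (h.lower x) hδ
    linarith [h₂ x]
  upper x := by
    have := mul_le_mul_of_nonneg_left (h₁ x) hξ
    linarith [h.upper x]

lemma Approximates.mono {κ ξ ξ' : ℝ} {A G : DualOp E} (h : Approximates κ ξ A G)
    (hA : PosDefOp A) (hξ : ξ ≤ ξ') : Approximates κ ξ' A G where
  posDef := h.posDef
  lower x := (h.lower x).trans (mul_le_mul_of_nonneg_right hξ (h.posDef.nonneg x))
  upper x := (h.upper x).trans (mul_le_mul_of_nonneg_right hξ (hA.nonneg x))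

lemma Approximates.broyd {κ ξ : ℝ} {A G : DualOp E} (h : Approximates κ ξ A G) (hA : PosDefOp A)
    (hκ : 0 < κ) (hκ' : κ ≤ 1) (hξ : 1 ≤ ξ) {φ : ℝ} (hφ : φ ∈ Set.Icc (0 : ℝ) 1) (u : E) :
    Approximates κ ξ A (Broyd φ A G u) where
  posDef := Broyd_posDef hA h.posDef hφ u
  lower := le_Broyd hA h.posDef hφ hξ h.lower u
  upper x := by
    have := Broyd_le hA h.posDef hφ (η := ξ / κ) ((one_le_div hκ).2 (hκ'.trans hξ))
      (fun y => by
        rw [div_mul_eq_mul_div, le_div_iff₀ hκ, mul_comm]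
        exact h.upper y) u x
    rwa [div_mul_eq_mul_div, le_div_iff₀ hκ, mul_comm] at this

lemma lam_nonneg (f : E → ℝ) (x : E) : 0 ≤ lam f x := Real.sqrt_nonneg _

variable [FiniteDimensional ℝ E]

/-- A zero denominator forces u = 0, so the default value of the division does no harm. -/
lemma residualRatio_mul {A G : DualOp E} (hA : PosDefOp A) (hG : PosDefOp G) (u : E) :
    residualRatio A G u * G u (A.inverse (G u)) = (G u - A u) (A.inverse (G u - A u)) := by
  by_cases hp : G u (A.inverse (G u)) = 0
  · have h₁ : A.inverse (G u) = 0 := hA.eq_zero_of_apply_self (by rw [hA.apply_inverse, hp])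
    have h₂ : G u = 0 := by rw [← hA.apply_inverse (G u), h₁, map_zero]
    have h₃ : u = 0 := by rw [← hG.inverse_apply u, h₂, map_zero]
    simp [h₃]
  · exact div_mul_cancel₀ _ hp

lemma Approximates.residualRatio_le {κ X ρ : ℝ} {A G : DualOp E} (h : Approximates κ X A G)
    (hA : PosDefOp A) (hκ : 0 < κ) (hX : 0 < X) (hρ : 0 < ρ) (h₁ : X ≤ 1 + ρ)
    (h₂ : 1 - ρ ≤ κ / X) (u : E) : residualRatio A G u ≤ ρ ^ 2 := by
  refine div_le_of_le_mul₀ (hA.inverse_nonneg _) (sq_nonneg ρ) ?_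
  have key := hA.residual_le h.posDef hρ (fun s => ?_) (fun s => ?_) (G u)
  · rwa [h.posDef.inverse_apply] at key
  · exact (hA.inverse_le h.posDef hX h.lower s).trans
      (mul_le_mul_of_nonneg_right h₁ (hA.inverse_nonneg s))
  · have h₃ := h.posDef.inverse_le hA (div_pos hX hκ) (fun x => by
      rw [div_mul_eq_mul_div, le_div_iff₀ hκ, mul_comm]
      exact h.upper x) s
    rw [div_mul_eq_mul_div, le_div_iff₀ hκ] at h₃
    have h₄ := mul_le_mul_of_nonneg_right h₂ (hA.inverse_nonneg s)
    refine h₄.trans ?_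
    rw [div_mul_eq_mul_div, div_le_iff₀ hX]
    linarith

/-- The symmetric potential `tr (A⁻¹ G) + tr (G⁻¹ A)`. -/
noncomputable def potential (A G : DualOp E) : ℝ :=
  relTrace A G + relTrace G A

lemma potential_le_of_comparable {A A' G : DualOp E} (hA : PosDefOp A) (hA' : PosDefOp A')
    (hG : PosDefOp G) {δ : ℝ} (hδ : 0 < δ) (h₁ : ∀ x, A x x ≤ δ * A' x x)
    (h₂ : ∀ x, A' x x ≤ δ * A x x) : potential A' G ≤ δ * potential A G := by
  rw [potential, potential, mul_add]
  exact add_le_add (relTrace_le_left hA hA' hG hδ h₁) (relTrace_le_right hG h₂)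

lemma Approximates.potential_broyd_add_le {κ X : ℝ} {A G : DualOp E} (h : Approximates κ X A G)
    (hA : PosDefOp A) (hκ : 0 < κ) (hX : 1 ≤ X) {φ : ℝ} (hφ : φ ∈ Set.Icc (0 : ℝ) 1) (u : E) :
    potential A (Broyd φ A G u) + (φ * κ + 1 - φ) * residualRatio A G u / X ^ 3
      ≤ potential A G :=
  relTrace_Broyd_add_le hA h.posDef hφ hX hκ h.lower h.upper u

variable {f : E → ℝ} {B : DualOp E} {μ L M : ℝ}

namespace IsAdmissible

lemma lam_sq (h : IsAdmissible f B μ L M) (x : E) :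
    lam f x ^ 2 = grad f x ((hess f x).inverse (grad f x)) :=
  Real.sq_sqrt ((h.hess_posDef x).inverse_nonneg _)

/-- The local length of a quasi-Newton step. -/
lemma primalNorm_step_le (h : IsAdmissible f B μ L M) {κ ξ : ℝ} (hξ : 0 < ξ) {x : E}
    {G : DualOp E} (hG : Approximates κ ξ (hess f x) G) {u : E} (hu : G u = -grad f x) :
    primalNorm (hess f x) u ≤ ξ * lam f x := by
  refine Real.sqrt_le_iff.2 ⟨mul_nonneg hξ.le (lam_nonneg f x), ?_⟩
  have h₁ := (h.hess_posDef x).inverse_le hG.posDef hξ hG.lower (G u)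
  rw [hG.posDef.inverse_apply] at h₁
  have h₂ : G u ((hess f x).inverse (G u)) = lam f x ^ 2 := by
    rw [h.lam_sq, hu]
    simp
  rw [h₂] at h₁
  calc hess f x u u ≤ ξ * G u u := hG.lower u
    _ ≤ ξ * (ξ * lam f x ^ 2) := mul_le_mul_of_nonneg_left h₁ hξ.le
    _ = (ξ * lam f x) ^ 2 := by ring

/-- The local gradient norm after a quasi-Newton step. -/
lemma lam_sq_step_le (h : IsAdmissible f B μ L M) {x u : E} {G : DualOp E}
    (hG : PosDefOp G) (hu : G u = -grad f x) :
    lam f (x + u) ^ 2 ≤ Real.exp (M * primalNorm (hess f x) u) *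
      residualRatio (integralHess f x u) G u * lam f x ^ 2 := by
  have hJ := h.integralHess_posDef x u
  have hb := h.integralHess_bounds x u
  have hδ := Real.exp_pos (M * primalNorm (hess f x) u / 2)
  have hδδ : Real.exp (M * primalNorm (hess f x) u / 2) *
      Real.exp (M * primalNorm (hess f x) u / 2) = Real.exp (M * primalNorm (hess f x) u) := by
    rw [← Real.exp_add]
    ring_nf
  set δ := Real.exp (M * primalNorm (hess f x) u / 2)
  have k₁ := hJ.inverse_le (h.hess_posDef (x + u)) hδ (fun v => (hb v).2.1) (grad f (x + u))
  have k₂ := (h.hess_posDef x).inverse_le hJ hδ (fun v => (hb v).1.2) (grad f x)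
  rw [← h.lam_sq] at k₁ k₂
  -- The secant identity: the new gradient is exactly the residual of G against J along u.
  have e₁ : G u - integralHess f x u u = -grad f (x + u) := by
    rw [h.grad_add, hu]
    abel
  have e₂ := residualRatio_mul hJ hG u
  rw [e₁, hu] at e₂
  simp only [map_neg, neg_apply, neg_neg] at e₂
  have hR := residualRatio_nonneg hJ G u
  rw [← e₂] at k₁
  calc lam f (x + u) ^ 2 ≤ _ := k₁
    _ ≤ δ * (residualRatio (integralHess f x u) G u * (δ * lam f x ^ 2)) := by gcongr
    _ = _ := by
      rw [← hδδ]
      ring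

/-- One step of the method: approximation quality of the operators. -/
lemma approximates_step (h : IsAdmissible f B μ L M) {κ ξ : ℝ} (hκ : 0 < κ) (hκ' : κ ≤ 1)
    (hξ : 1 ≤ ξ) {x : E} {G : DualOp E} (hG : Approximates κ ξ (hess f x) G) {φ : ℝ}
    (hφ : φ ∈ Set.Icc (0 : ℝ) 1) (u : E) :
    Approximates κ (ξ * Real.exp (M * primalNorm (hess f x) u)) (integralHess f x u) G ∧
      Approximates κ (ξ * Real.exp (M * primalNorm (hess f x) u)) (hess f (x + u))
        (Broyd φ (integralHess f x u) G u) := by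
  have hJ := h.integralHess_posDef x u
  have hb := h.integralHess_bounds x u
  have hr : 0 ≤ M * primalNorm (hess f x) u := mul_nonneg h.M_nonneg (Real.sqrt_nonneg _)
  have hδ : 1 ≤ Real.exp (M * primalNorm (hess f x) u / 2) := Real.one_le_exp (by linarith)
  have hδδ : Real.exp (M * primalNorm (hess f x) u) =
      Real.exp (M * primalNorm (hess f x) u / 2) * Real.exp (M * primalNorm (hess f x) u / 2) := by
    rw [← Real.exp_add]
    ring_nf
  rw [hδδ, ← mul_assoc]
  set δ := Real.exp (M * primalNorm (hess f x) u / 2)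
  have hξδ : 1 ≤ ξ * δ := one_le_mul_of_one_le_of_one_le hξ hδ
  have h₁ := hG.change (by linarith) (by linarith) (fun v => (hb v).1.2) (fun v => (hb v).1.1)
  exact ⟨h₁.mono hJ (le_mul_of_one_le_right (by linarith) hδ),
    (h₁.broyd hJ hκ hκ' hξδ hφ u).change (by linarith) (by linarith)
      (fun v => (hb v).2.1) (fun v => (hb v).2.2)⟩

/-- One step of the method: decrease of the potential. -/
lemma potential_step (h : IsAdmissible f B μ L M) {κ X : ℝ} (hκ : 0 < κ)
    (hX : 1 ≤ X) {x u : E} {G : DualOp E} (hG : Approximates κ X (integralHess f x u) G) {φ : ℝ}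
    (hφ : φ ∈ Set.Icc (0 : ℝ) 1) (hw : 0 ≤ φ * κ + 1 - φ) :
    potential (hess f (x + u)) (Broyd φ (integralHess f x u) G u)
        + (φ * κ + 1 - φ) * residualRatio (integralHess f x u) G u / X ^ 3
      ≤ Real.exp (M * primalNorm (hess f x) u) * potential (hess f x) G := by
  have hJ := h.integralHess_posDef x u
  have hb := h.integralHess_bounds x u
  have hr : 0 ≤ M * primalNorm (hess f x) u := mul_nonneg h.M_nonneg (Real.sqrt_nonneg _)
  have hδ : 1 ≤ Real.exp (M * primalNorm (hess f x) u / 2) := Real.one_le_exp (by linarith)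
  have hδδ : Real.exp (M * primalNorm (hess f x) u) =
      Real.exp (M * primalNorm (hess f x) u / 2) * Real.exp (M * primalNorm (hess f x) u / 2) := by
    rw [← Real.exp_add]
    ring_nf
  rw [hδδ]
  set δ := Real.exp (M * primalNorm (hess f x) u / 2)
  have hδ₀ : 0 < δ := by linarith
  have h₁ := potential_le_of_comparable (h.hess_posDef x) hJ hG.posDef hδ₀
    (fun v => (hb v).1.2) (fun v => (hb v).1.1)
  have h₂ := hG.potential_broyd_add_le hJ hκ hX hφ u
  have h₃ := potential_le_of_comparable hJ (h.hess_posDef (x + u))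
    (Broyd_posDef hJ hG.posDef hφ u) hδ₀ (fun v => (hb v).2.1) (fun v => (hb v).2.2)
  have h₄ : 0 ≤ (φ * κ + 1 - φ) * residualRatio (integralHess f x u) G u / X ^ 3 := by
    have := residualRatio_nonneg hJ G u
    positivity
  nlinarith [mul_le_mul_of_nonneg_left h₁ hδ₀.le, mul_le_mul_of_nonneg_left h₂ hδ₀.le,
    mul_le_mul_of_nonneg_right hδ h₄]

/-- Linear convergence of one step. -/
lemma lam_step_le (h : IsAdmissible f B μ L M) {κ : ℝ} (hκ : 0 < κ) (hκ' : κ ≤ 1) {x u : E}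
    {G : DualOp E} (hu : G u = -grad f x) (hG : Approximates κ (7 / 5) (integralHess f x u) G)
    (hr : M * primalNorm (hess f x) u ≤ 7 / 40 * κ) :
    lam f (x + u) ≤ (1 - κ / 2) * lam f x := by
  set r := M * primalNorm (hess f x) u with hrdef
  -- The second factor is reserved to absorb exp(r/2); for κ ≤ 1 both 7/5 ≤ 1 + ρ and 1 - ρ ≤ 5κ/7
  -- still hold.
  set ρ := (1 - κ / 2) * (1 - 7 / 80 * κ) with hρ
  have hρ₀ : 0 < ρ := mul_pos (by linarith) (by linarith)
  have hR := hG.residualRatio_le (h.integralHess_posDef x u) hκ (by norm_num) hρ₀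
    (by nlinarith) (by nlinarith) u
  have h₁ := h.lam_sq_step_le hG.posDef hu
  have hexp : Real.exp (r / 2) * (1 - 7 / 80 * κ) ≤ 1 := by
    have h₂ : 1 - 7 / 80 * κ ≤ Real.exp (-(r / 2)) := by
      linarith [Real.add_one_le_exp (-(r / 2))]
    calc _ ≤ Real.exp (r / 2) * Real.exp (-(r / 2)) := by gcongr
      _ = 1 := by rw [← Real.exp_add]; simp
  have hlam := lam_nonneg f x
  refine le_of_sq_le_sq ?_ (mul_nonneg (by linarith) hlam)
  calc lam f (x + u) ^ 2 ≤ Real.exp r * ρ ^ 2 * lam f x ^ 2 := h₁.trans (by gcongr)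
    _ = ((Real.exp (r / 2) * (1 - 7 / 80 * κ)) * ((1 - κ / 2) * lam f x)) ^ 2 := by
      rw [show Real.exp r = Real.exp (r / 2) * Real.exp (r / 2) by
        rw [← Real.exp_add]; ring_nf, hρ]
      ring
    _ ≤ (1 * ((1 - κ / 2) * lam f x)) ^ 2 := by
      have : 0 ≤ (1 - κ / 2) * lam f x := mul_nonneg (by linarith) hlam
      have : 0 ≤ 1 - 7 / 80 * κ := by linarith
      gcongr
    _ = _ := by rw [one_mul]

end IsAdmissible

end Step

/-! ### The whole run: bounded path length and linear convergence -/

section Run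

variable {E : Type*} [NormedAddCommGroup E] [NormedSpace ℝ E]

lemma prod_le_arith_mean_pow {z : ℕ → ℝ} (hz : ∀ i, 0 ≤ z i) {k : ℕ} (hk : 1 ≤ k) :
    ∏ i ∈ Finset.range k, z i ≤ ((∑ i ∈ Finset.range k, z i) / k) ^ k := by
  have hk₀ : (0 : ℝ) < k := by exact_mod_cast hk
  have h := Real.geom_mean_le_arith_mean (Finset.range k) (fun _ => 1) z (by simp)
    (by simpa using Nat.pos_of_ne_zero (by omega)) (fun i _ => hz i)
  simp only [Real.rpow_one, Finset.sum_const, Finset.card_range, nsmul_eq_mul, mul_one,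
    one_mul] at h
  have hp : 0 ≤ ∏ i ∈ Finset.range k, z i := Finset.prod_nonneg fun i _ => hz i
  calc ∏ i ∈ Finset.range k, z i = ((∏ i ∈ Finset.range k, z i) ^ (k : ℝ)⁻¹) ^ k := by
        rw [Real.rpow_inv_natCast_pow hp (by omega)]
    _ ≤ _ := pow_le_pow_left₀ (Real.rpow_nonneg hp _) h k

/-- The accumulated local length of the first `k` steps, multiplied by `M`. -/
noncomputable def pathLength (f : E → ℝ) (M : ℝ) (x : ℕ → E) (k : ℕ) : ℝ :=
  ∑ i ∈ Finset.range k, M * primalNorm (hess f (x i)) (x (i + 1) - x i)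

lemma pathLength_succ (f : E → ℝ) (M : ℝ) (x : ℕ → E) (k : ℕ) :
    pathLength f M x (k + 1) =
      pathLength f M x k + M * primalNorm (hess f (x k)) (x (k + 1) - x k) :=
  Finset.sum_range_succ _ k

lemma pathLength_nonneg {M : ℝ} (hM : 0 ≤ M) (f : E → ℝ) (x : ℕ → E) (k : ℕ) :
    0 ≤ pathLength f M x k :=
  Finset.sum_nonneg fun _ _ => mul_nonneg hM (Real.sqrt_nonneg _)

lemma exp_le_of_le_log {D : ℝ} (hD : D ≤ 7 / 10 * Real.log (3 / 2)) : Real.exp D ≤ 7 / 5 := by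
  have hlog : 0 < Real.log (3 / 2) := Real.log_pos (by norm_num)
  -- Four times 7/10 is at most 3, and (3/2)³ < (7/5)⁴.
  have h : Real.exp D ^ 4 ≤ (3 / 2) ^ 3 := by
    rw [← Real.exp_nat_mul, ← Real.exp_log (show (0 : ℝ) < 3 / 2 by norm_num), ← Real.exp_nat_mul]
    refine Real.exp_le_exp.2 ?_
    push_cast
    linarith
  by_contra! h'
  have := pow_lt_pow_left₀ h' (by norm_num) (n := 4) (by norm_num)
  norm_num at h this
  linarith

lemma lam_eq_zero_of_subsingleton [Subsingleton E] (f : E → ℝ) (y : E) : lam f y = 0 := by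
  simp [lam, dualNorm, Subsingleton.elim (grad f y) 0]

lemma posDefOp_of_subsingleton [Subsingleton E] (A : DualOp E) : PosDefOp A :=
  ⟨fun v w => by rw [Subsingleton.elim v w], fun v hv => (hv (Subsingleton.elim v 0)).elim⟩

variable {f : E → ℝ} {B : DualOp E} {μ L M : ℝ} {φ : ℕ → ℝ} {x : ℕ → E} {G : ℕ → DualOp E}

/-- The property of the `k`-th iterate that is propagated by the method. -/
structure GoodIterate (f : E → ℝ) (M κ : ℝ) (x : ℕ → E) (G : ℕ → DualOp E) (k : ℕ) : Prop where
  approx : Approximates κ (Real.exp (pathLength f M x k)) (hess f (x k)) (G k)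
  budget : pathLength f M x k + 14 / 5 * (M * lam f (x k)) / κ ≤ 7 / 10 * Real.log (3 / 2)

lemma GoodIterate.exp_le {κ : ℝ} {k : ℕ} (hk : GoodIterate f M κ x G k) (hM : 0 ≤ M)
    (hκ : 0 < κ) : Real.exp (pathLength f M x k) ≤ 7 / 5 := by
  have h : 0 ≤ 14 / 5 * (M * lam f (x k)) / κ := by
    have := lam_nonneg f (x k)
    positivity
  exact exp_le_of_le_log (by linarith [hk.budget])

variable [FiniteDimensional ℝ E]

lemma IsQuasiNewtonRun.apply_sub (hrun : IsQuasiNewtonRun f B L φ x G) {k : ℕ}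
    (hG : PosDefOp (G k)) : G k (x (k + 1) - x k) = -grad f (x k) := by
  rw [hrun.step k, sub_sub_cancel_left, map_neg, hG.apply_inverse]

lemma GoodIterate.next_aux {κ : ℝ} {k : ℕ} (hk : GoodIterate f M κ x G k)
    (h : IsAdmissible f B μ L M) (hrun : IsQuasiNewtonRun f B L φ x G) (hκ : 0 < κ)
    (hκ' : κ ≤ 1) :
    M * primalNorm (hess f (x k)) (x (k + 1) - x k) ≤ 7 / 5 * (M * lam f (x k)) ∧
      M * primalNorm (hess f (x k)) (x (k + 1) - x k) ≤ 7 / 40 * κ ∧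
      Real.exp (pathLength f M x (k + 1)) ≤ 7 / 5 := by
  have hlam := lam_nonneg f (x k)
  have hu := hrun.apply_sub hk.approx.posDef
  have hstep := h.primalNorm_step_le (Real.exp_pos _) hk.approx hu
  have hr : M * primalNorm (hess f (x k)) (x (k + 1) - x k) ≤ 7 / 5 * (M * lam f (x k)) := by
    calc _ ≤ M * (7 / 5 * lam f (x k)) := by
          refine mul_le_mul_of_nonneg_left (hstep.trans ?_) h.M_nonneg
          exact mul_le_mul_of_nonneg_right (hk.exp_le h.M_nonneg hκ) hlam
      _ = _ := by ring
  have hD := pathLength_nonneg h.M_nonneg f x k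
  have hb := hk.budget
  have hMl : 0 ≤ M * lam f (x k) := mul_nonneg h.M_nonneg hlam
  have hlog : Real.log (3 / 2) ≤ 1 / 2 := by
    have := Real.log_le_sub_one_of_pos (show (0 : ℝ) < 3 / 2 by norm_num)
    linarith
  have hb' : 14 / 5 * (M * lam f (x k)) ≤ 7 / 10 * Real.log (3 / 2) * κ := by
    rw [← div_le_iff₀ hκ]
    linarith
  refine ⟨hr, by nlinarith, exp_le_of_le_log ?_⟩
  rw [pathLength_succ]
  have : 14 / 5 * (M * lam f (x k)) ≤ 14 / 5 * (M * lam f (x k)) / κ :=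
    le_div_self (by positivity) hκ hκ'
  linarith

lemma GoodIterate.approx_integralHess {κ : ℝ} {k : ℕ} (hk : GoodIterate f M κ x G k)
    (h : IsAdmissible f B μ L M) (hrun : IsQuasiNewtonRun f B L φ x G) (hκ : 0 < κ)
    (hκ' : κ ≤ 1) :
    Approximates κ (7 / 5) (integralHess f (x k) (x (k + 1) - x k)) (G k) := by
  have h₁ := (h.approximates_step hκ hκ' (Real.one_le_exp (pathLength_nonneg h.M_nonneg f x k))
    hk.approx (hrun.param_mem k) (x (k + 1) - x k)).1
  rw [← Real.exp_add, ← pathLength_succ] at h₁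
  exact h₁.mono (h.integralHess_posDef _ _) (hk.next_aux h hrun hκ hκ').2.2

/-- The budget never grows: linear convergence lowers its second term by at least (14/5)(κ/2)Mλ_k/κ
= (7/5)Mλ_k, which covers the new step length. -/
lemma GoodIterate.succ {κ : ℝ} {k : ℕ} (hk : GoodIterate f M κ x G k)
    (h : IsAdmissible f B μ L M) (hrun : IsQuasiNewtonRun f B L φ x G) (hκ : 0 < κ)
    (hκ' : κ ≤ 1) : GoodIterate f M κ x G (k + 1) := by
  obtain ⟨hr, hr', -⟩ := hk.next_aux h hrun hκ hκ'
  have h₁ := (h.approximates_step hκ hκ' (Real.one_le_exp (pathLength_nonneg h.M_nonneg f x k))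
    hk.approx (hrun.param_mem k) (x (k + 1) - x k)).2
  rw [← Real.exp_add, ← pathLength_succ, ← hrun.update k, add_sub_cancel] at h₁
  refine ⟨h₁, ?_⟩
  have h₂ := h.lam_step_le hκ hκ' (hrun.apply_sub hk.approx.posDef)
    (hk.approx_integralHess h hrun hκ hκ') hr'
  rw [add_sub_cancel] at h₂
  have h₃ := mul_le_mul_of_nonneg_left h₂ h.M_nonneg
  have h₄ : 14 / 5 * (M * lam f (x (k + 1))) / κ
      ≤ 14 / 5 * (M * ((1 - κ / 2) * lam f (x k))) / κ := by gcongr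
  have h₅ : 14 / 5 * (M * ((1 - κ / 2) * lam f (x k))) / κ
      = 14 / 5 * (M * lam f (x k)) / κ - 7 / 5 * (M * lam f (x k)) := by
    field_simp
    ring
  rw [pathLength_succ]
  linarith [hk.budget]

lemma goodIterate (h : IsAdmissible f B μ L M) (hrun : IsQuasiNewtonRun f B L φ x G)
    (hμL : μ ≤ L) (hinit : M * lam f (x 0) ≤ Real.log (3 / 2) / 4 * (μ / L)) (k : ℕ) :
    GoodIterate f M (μ / L) x G k := by
  have hκ := div_pos h.mu_pos h.L_pos
  have hκ' : μ / L ≤ 1 := (div_le_one h.L_pos).2 hμL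
  induction k with
  | zero =>
    refine ⟨⟨?_, fun v => ?_, fun v => ?_⟩, ?_⟩
    · rw [hrun.init]
      exact h.posDef.smul h.L_pos
    · simpa [hrun.init, pathLength] using h.hess_le_L (x 0) v
    · have h₁ : μ / L * (L * B v v) = μ * B v v := by
        rw [← mul_assoc, div_mul_cancel₀ _ h.L_pos.ne']
      simpa [hrun.init, pathLength, h₁] using h.mu_le_hess (x 0) v
    · have h₁ : 14 / 5 * (M * lam f (x 0)) / (μ / L) ≤ 7 / 10 * Real.log (3 / 2) := by
        rw [div_le_iff₀ hκ]
        linarith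
      simpa [pathLength] using h₁
  | succ k ih => exact ih.succ h hrun hκ hκ'

/-! ### Summed potential decrease and the superlinear rate -/

lemma potential_init_le (h : IsAdmissible f B μ L M) (hμL : μ ≤ L) (y : E) :
    potential (hess f y) (L • B) ≤ 2 * Module.finrank ℝ E / (μ / L) := by
  have hκ := div_pos h.mu_pos h.L_pos
  have hκ' : μ / L ≤ 1 := (div_le_one h.L_pos).2 hμL
  have hH := h.hess_posDef y
  have hB := h.posDef.smul h.L_pos
  have h₁ := relTrace_le_right hH (G := L • B) (G' := hess f y) (c := (μ / L)⁻¹) fun v => by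
    rw [inv_mul_eq_div, le_div_iff₀ hκ]
    have e : (L • B) v v * (μ / L) = μ * B v v := by
      have := h.L_pos.ne'
      simp only [smul_apply, smul_eq_mul]
      field_simp
    rw [e]
    exact h.mu_le_hess y v
  have h₂ := relTrace_le_right hB (G := hess f y) (G' := L • B) (c := 1) fun v => by
    simpa using h.hess_le_L y v
  rw [relTrace_self hH] at h₁
  rw [relTrace_self hB] at h₂
  have h₃ : 1 * (Module.finrank ℝ E : ℝ) ≤ (μ / L)⁻¹ * Module.finrank ℝ E :=
    mul_le_mul_of_nonneg_right ((one_le_inv₀ hκ).2 hκ') (Nat.cast_nonneg _)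
  calc potential (hess f y) (L • B) ≤ 2 * ((μ / L)⁻¹ * Module.finrank ℝ E) := by
        rw [potential]
        linarith
    _ = _ := by ring

lemma potential_nonneg {A K : DualOp E} (hA : PosDefOp A) (hK : PosDefOp K) :
    0 ≤ potential A K := by
  have h₁ := relTrace_le_right hA (G := 0) (G' := K) (c := 1) fun v => by
    simpa using hK.nonneg v
  have h₂ := relTrace_le_right hK (G := 0) (G' := A) (c := 1) fun v => by
    simpa using hA.nonneg v
  simp only [relTrace, ContinuousLinearMap.comp_zero, ContinuousLinearMap.toLinearMap_zero,
    map_zero, one_mul] at h₁ h₂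
  exact add_nonneg h₁ h₂

/-- The residual ratio of the `k`-th step. -/
noncomputable def stepRatio (f : E → ℝ) (x : ℕ → E) (G : ℕ → DualOp E) (k : ℕ) : ℝ :=
  residualRatio (integralHess f (x k) (x (k + 1) - x k)) (G k) (x (k + 1) - x k)

lemma stepRatio_nonneg (h : IsAdmissible f B μ L M) (x : ℕ → E) (G : ℕ → DualOp E) (k : ℕ) :
    0 ≤ stepRatio f x G k :=
  residualRatio_nonneg (h.integralHess_posDef _ _) _ _

lemma lam_sq_le_prod (h : IsAdmissible f B μ L M) (hrun : IsQuasiNewtonRun f B L φ x G)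
    (hG : ∀ k, PosDefOp (G k)) (k : ℕ) :
    lam f (x k) ^ 2 ≤ Real.exp (pathLength f M x k) *
      (∏ i ∈ Finset.range k, stepRatio f x G i) * lam f (x 0) ^ 2 := by
  induction k with
  | zero => simp [pathLength]
  | succ k ih =>
    have h₁ := h.lam_sq_step_le (hG k) (hrun.apply_sub (hG k))
    rw [add_sub_cancel] at h₁
    have hR := stepRatio_nonneg h x G k
    refine h₁.trans ((mul_le_mul_of_nonneg_left ih (mul_nonneg (Real.exp_pos _).le hR)).trans_eq ?_)
    rw [pathLength_succ, Real.exp_add, Finset.prod_range_succ, stepRatio]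
    ring

lemma weight_pos {κ : ℝ} (hκ : 0 < κ) {φ : ℝ} (hφ : φ ∈ Set.Icc (0 : ℝ) 1) :
    0 < φ * κ + 1 - φ := by
  rcases hφ.1.eq_or_lt with rfl | h
  · norm_num
  · nlinarith [hφ.2, mul_pos h hκ]

lemma sum_weighted_stepRatio_le (h : IsAdmissible f B μ L M)
    (hrun : IsQuasiNewtonRun f B L φ x G) (hμL : μ ≤ L)
    (hinit : M * lam f (x 0) ≤ Real.log (3 / 2) / 4 * (μ / L)) (k : ℕ) :
    ∑ i ∈ Finset.range k, (φ i * (μ / L) + 1 - φ i) * stepRatio f x G i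
      ≤ (7 / 5) ^ 4 * (2 * Module.finrank ℝ E / (μ / L)) := by
  have hκ := div_pos h.mu_pos h.L_pos
  have hκ' : μ / L ≤ 1 := (div_le_one h.L_pos).2 hμL
  have hgood := goodIterate h hrun hμL hinit
  have hw := fun i => weight_pos hκ (hrun.param_mem i)
  -- Discounting by exp(-D_k) cancels the growth of the potential caused by the moving Hessian, so
  -- the sum telescopes. Of the four factors 7/5, three come from X³ and one from the discount.
  have key : ∀ k, Real.exp (-pathLength f M x k) * potential (hess f (x k)) (G k) +
      (∑ i ∈ Finset.range k, (φ i * (μ / L) + 1 - φ i) * stepRatio f x G i) / (7 / 5) ^ 4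
        ≤ potential (hess f (x 0)) (G 0) := by
    intro k
    induction k with
    | zero => simp [pathLength]
    | succ k ih =>
      have h₁ := h.potential_step hκ (by norm_num) ((hgood k).approx_integralHess h hrun hκ hκ')
        (hrun.param_mem k) (hw k).le
      rw [← hrun.update k, add_sub_cancel] at h₁
      have hexp : (7 / 5 : ℝ)⁻¹ ≤ Real.exp (-pathLength f M x (k + 1)) := by
        rw [Real.exp_neg]
        exact inv_anti₀ (Real.exp_pos _) ((hgood (k + 1)).exp_le h.M_nonneg hκ)
      have hwR := mul_nonneg (hw k).le (stepRatio_nonneg h x G k)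
      have h₂ := mul_le_mul_of_nonneg_left h₁ (Real.exp_pos (-pathLength f M x (k + 1))).le
      rw [← mul_assoc, ← Real.exp_add, show -pathLength f M x (k + 1) +
        M * primalNorm (hess f (x k)) (x (k + 1) - x k) = -pathLength f M x k by
          rw [pathLength_succ]; ring, mul_add] at h₂
      have h₃ := mul_le_mul_of_nonneg_right hexp
        (div_nonneg hwR (by norm_num : (0 : ℝ) ≤ (7 / 5) ^ 3))
      have h₄ : (7 / 5 : ℝ)⁻¹ * ((φ k * (μ / L) + 1 - φ k) * stepRatio f x G k / (7 / 5) ^ 3)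
          = (φ k * (μ / L) + 1 - φ k) * stepRatio f x G k / (7 / 5) ^ 4 := by
        ring
      rw [Finset.sum_range_succ, add_div]
      rw [h₄] at h₃
      unfold stepRatio at *
      linarith
  have h₁ := key k
  rw [hrun.init] at h₁
  have h₂ := potential_init_le h hμL (x 0)
  have h₃ := mul_nonneg (Real.exp_pos (-pathLength f M x k)).le
    (potential_nonneg (h.hess_posDef (x k)) (hgood k).approx.posDef)
  have h₄ : (∑ i ∈ Finset.range k, (φ i * (μ / L) + 1 - φ i) * stepRatio f x G i) / (7 / 5) ^ 4
      ≤ 2 * Module.finrank ℝ E / (μ / L) := by linarith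
  rw [div_le_iff₀ (by norm_num)] at h₄
  linarith

lemma lam_sq_mul_prod_weight_le (h : IsAdmissible f B μ L M)
    (hrun : IsQuasiNewtonRun f B L φ x G) (hμL : μ ≤ L)
    (hinit : M * lam f (x 0) ≤ Real.log (3 / 2) / 4 * (μ / L)) {k : ℕ} (hk : 1 ≤ k) :
    lam f (x k) ^ 2 * ∏ i ∈ Finset.range k, (φ i * (μ / L) + 1 - φ i)
      ≤ (11 * (Module.finrank ℝ E : ℝ) * L / (μ * k)) ^ k * lam f (x 0) ^ 2 := by
  have hμ := h.mu_pos
  have hL := h.L_pos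
  have hκ := div_pos hμ hL
  have hk₀ : (0 : ℝ) < k := by exact_mod_cast hk
  have hgood := goodIterate h hrun hμL hinit
  have hw := fun i => weight_pos hκ (hrun.param_mem i)
  have hR := stepRatio_nonneg h x G
  have h₁ := lam_sq_le_prod h hrun (fun k => (hgood k).approx.posDef) k
  have h₂ := prod_le_arith_mean_pow (fun i => mul_nonneg (hw i).le (hR i)) hk
  have h₃ := sum_weighted_stepRatio_le h hrun hμL hinit k
  have hW : 0 ≤ ∏ i ∈ Finset.range k, (φ i * (μ / L) + 1 - φ i) :=
    Finset.prod_nonneg fun i _ => (hw i).le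
  have hS : 0 ≤ ∑ i ∈ Finset.range k, (φ i * (μ / L) + 1 - φ i) * stepRatio f x G i :=
    Finset.sum_nonneg fun i _ => mul_nonneg (hw i).le (hR i)
  -- Since k ≥ 1, the single factor 7/5 may be raised to the power k and merged into the base.
  have hexp : Real.exp (pathLength f M x k) ≤ (7 / 5) ^ k :=
    ((hgood k).exp_le h.M_nonneg hκ).trans (le_self_pow₀ (by norm_num) (by omega))
  set W := ∏ i ∈ Finset.range k, (φ i * (μ / L) + 1 - φ i)
  rw [Finset.prod_mul_distrib] at h₂
  calc lam f (x k) ^ 2 * W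
      ≤ Real.exp (pathLength f M x k) * (∏ i ∈ Finset.range k, stepRatio f x G i)
          * lam f (x 0) ^ 2 * W := mul_le_mul_of_nonneg_right h₁ hW
    _ = Real.exp (pathLength f M x k) * (W * ∏ i ∈ Finset.range k, stepRatio f x G i)
          * lam f (x 0) ^ 2 := by ring
    _ ≤ (7 / 5) ^ k * (((7 / 5) ^ 4 * (2 * Module.finrank ℝ E / (μ / L))) / k) ^ k
          * lam f (x 0) ^ 2 := by
      refine mul_le_mul_of_nonneg_right ?_ (sq_nonneg _)
      refine mul_le_mul hexp (h₂.trans ?_)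
        (mul_nonneg hW (Finset.prod_nonneg fun i _ => hR i)) (by positivity)
      gcongr
    _ = (2 * (7 / 5) ^ 5 * (Module.finrank ℝ E : ℝ) * L / (μ * k)) ^ k * lam f (x 0) ^ 2 := by
      rw [← mul_pow]
      congr 2
      field_simp
    _ ≤ _ := by
      -- The constant 11 is 2 · (7/5)⁵ ≈ 10.76 rounded up.
      gcongr
      norm_num

lemma lam_le_superlinear (h : IsAdmissible f B μ L M)
    (hrun : IsQuasiNewtonRun f B L φ x G) (hμL : μ ≤ L)
    (hinit : M * lam f (x 0) ≤ Real.log (3 / 2) / 4 * (μ / L)) {k : ℕ} (hk : 1 ≤ k) :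
    lam f (x k) ≤ 1 / (∏ i ∈ Finset.range k, (φ i * (μ / L) + 1 - φ i) ^ ((1 : ℝ) / 2)) *
      (11 * (Module.finrank ℝ E : ℝ) * L / (μ * k)) ^ ((k : ℝ) / 2) * lam f (x 0) := by
  have hμ := h.mu_pos
  have hL := h.L_pos
  have hw := fun i => weight_pos (div_pos hμ hL) (hrun.param_mem i)
  have key := lam_sq_mul_prod_weight_le h hrun hμL hinit hk
  have hY : 0 ≤ 11 * (Module.finrank ℝ E : ℝ) * L / (μ * k) := by positivity
  have hW : 0 < ∏ i ∈ Finset.range k, (φ i * (μ / L) + 1 - φ i) :=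
    Finset.prod_pos fun i _ => hw i
  rw [Real.finsetProd_rpow _ _ fun i _ => (hw i).le, ← Real.sqrt_eq_rpow,
    show (k : ℝ) / 2 = k * (1 / 2) by ring, Real.rpow_mul hY, ← Real.sqrt_eq_rpow,
    Real.rpow_natCast, one_div, mul_assoc, inv_mul_eq_div, le_div_iff₀ (Real.sqrt_pos.2 hW)]
  have := Real.sqrt_le_sqrt key
  rwa [Real.sqrt_mul (sq_nonneg _), Real.sqrt_mul (by positivity), Real.sqrt_sq (lam_nonneg _ _),
    Real.sqrt_sq (lam_nonneg _ _)] at this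

end Run

end QuasiNewton

theorem mainTheorem1 {E : Type*} [NormedAddCommGroup E] [NormedSpace ℝ E] [FiniteDimensional ℝ E]
    (f : E → ℝ) (hf : Differentiable ℝ f) (hf' : Differentiable ℝ (fderiv ℝ f))
    (B : QuasiNewton.DualOp E) (hB : QuasiNewton.PosDefOp B)
    (μ L M : ℝ) (hμ : 0 < μ) (hL : 0 < L) (hM : 0 ≤ M)
    (hconv : ∀ y, QuasiNewton.OpLE (μ • B) (QuasiNewton.hess f y))
    (hsmooth : ∀ y, QuasiNewton.OpLE (QuasiNewton.hess f y) (L • B))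
    (hsc : QuasiNewton.StronglySelfConcordant f M)
    (φ : ℕ → ℝ) (x : ℕ → E) (G : ℕ → QuasiNewton.DualOp E)
    (hrun : QuasiNewton.IsQuasiNewtonRun f B L φ x G)
    (hinit : M * QuasiNewton.lam f (x 0) ≤ Real.log (3 / 2) / 4 * (μ / L)) :
    -- the scheme is well defined
    (∀ k, QuasiNewton.PosDefOp (G k) ∧
      QuasiNewton.PosDefOp (QuasiNewton.integralHess f (x k) (x (k + 1) - x k))) ∧
    -- the general bound
    (∀ k : ℕ, 1 ≤ k →
      QuasiNewton.lam f (x k) ≤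
        1 / (∏ i ∈ Finset.range k, (φ i * (μ / L) + 1 - φ i) ^ ((1 : ℝ) / 2)) *
          (11 * (Module.finrank ℝ E : ℝ) * L / (μ * k)) ^ ((k : ℝ) / 2) *
          QuasiNewton.lam f (x 0)) ∧
    -- the BFGS method
    ((∀ i, φ i = 0) → ∀ k : ℕ, 1 ≤ k →
      QuasiNewton.lam f (x k) ≤
        (11 * (Module.finrank ℝ E : ℝ) * L / (μ * k)) ^ ((k : ℝ) / 2) *
          QuasiNewton.lam f (x 0)) ∧
    -- the DFP method
    ((∀ i, φ i = 1) → ∀ k : ℕ, 1 ≤ k →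
      QuasiNewton.lam f (x k) ≤
        (11 * (Module.finrank ℝ E : ℝ) * L ^ 2 / (μ ^ 2 * k)) ^ ((k : ℝ) / 2) *
          QuasiNewton.lam f (x 0)) := by
  have h : QuasiNewton.IsAdmissible f B μ L M :=
    ⟨hf, hf', hB, hμ, hL, hM, hconv, hsmooth, hsc⟩
  have hgen : (∀ k, QuasiNewton.PosDefOp (G k)) ∧ ∀ k : ℕ, 1 ≤ k → QuasiNewton.lam f (x k) ≤
      1 / (∏ i ∈ Finset.range k, (φ i * (μ / L) + 1 - φ i) ^ ((1 : ℝ) / 2)) *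
        (11 * (Module.finrank ℝ E : ℝ) * L / (μ * k)) ^ ((k : ℝ) / 2) *
        QuasiNewton.lam f (x 0) := by
    -- In dimension zero μ ≤ L may fail, but every λ vanishes there.
    rcases subsingleton_or_nontrivial E with hE | hE
    · refine ⟨fun k => QuasiNewton.posDefOp_of_subsingleton _, fun k _ => ?_⟩
      simp [QuasiNewton.lam_eq_zero_of_subsingleton]
    · exact ⟨fun k => (QuasiNewton.goodIterate h hrun h.mu_le_L hinit k).approx.posDef,
        fun k hk => QuasiNewton.lam_le_superlinear h hrun h.mu_le_L hinit hk⟩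
  refine ⟨fun k => ⟨hgen.1 k, h.integralHess_posDef _ _⟩, hgen.2, fun hφ k hk => ?_,
    fun hφ k hk => ?_⟩
  · simpa [hφ] using hgen.2 k hk
  · refine (hgen.2 k hk).trans_eq ?_
    have hκ : 0 < μ / L := div_pos hμ hL
    have hY : 0 ≤ 11 * (Module.finrank ℝ E : ℝ) * L / (μ * k) := by positivity
    have hprod : ∏ i ∈ Finset.range k, (φ i * (μ / L) + 1 - φ i) ^ ((1 : ℝ) / 2)
        = (μ / L) ^ ((k : ℝ) / 2) := by
      simp only [hφ, one_mul, add_sub_cancel_right, Finset.prod_const, Finset.card_range]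
      rw [← Real.rpow_mul_natCast hκ.le]
      congr 1
      ring
    rw [hprod, one_div_mul_eq_div, ← Real.div_rpow hY hκ.le]
    congr 2
    field_simp
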